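/- Theorem (Monadicity for traces). Let $k$ be a field. Let $\mathrm{LFP}_k$ be the 2-category of $k$-linear locally finitely presentable categories, $k$-linear cocontinuous functors and natural transformations; "compact" means "finitely presentable". Let $\mathcal A$ be a braided tensor category, in its large form (up to equivalence, the ind-completion of an essentially small finitely cocomplete $k$-linear rigid braided monoidal category with $k$-bilinear right exact tensor product). That is, $\mathcal A\in\mathrm{LFP}_k$ has a braided monoidal structure whose tensor product is $k$-bilinear and cocontinuous in each variable, the unit is compact, the compact objects are closed under $\otimes$, and every compact object has a left and a right dual. Let $\mathcal A\times\mathcal A\to\mathcal A\boxtimes\mathcal A$, $(a,b)\mapsto a\boxtimes b$, be the Deligne–Kelly tensor product: the universal functor to a category in $\mathrm{LFP}_k$ which is $k$-linear and cocontinuous in each variable; it preserves compactness. Equip $\mathcal A\boxtimes\mathcal A$ with its cocontinuous $k$-bilinear monoidal structure, for which $\boxtimes$ is strong monoidal. Let $T:\mathcal A\boxtimes\mathcal A\to\mathcal A$ be the tensor product functor, i.e. the $k$-linear cocontinuous functor with $T(a\boxtimes b)\cong a\otimes b$, with the strong monoidal structure given on generators by the isomorphisms $(a\otimes b)\otimes(a'\otimes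 b')\cong(a\otimes a')\otimes(b\otimes b')$ coming from the braiding $b\otimes a'\to a'\otimes b$. Regard $\mathcal A$ as a right and as a left module category over $\mathcal A\boxtimes\mathcal A$ by $a\cdot c=a\otimes T(c)$ and $c\cdot a=T(c)\otimes a$. Let $\underline{\mathrm{End}}_{\mathcal A\boxtimes\mathcal A}(\mathbf 1_{\mathcal A})$ be the algebra of internal endomorphisms of $\mathbf 1_{\mathcal A}$ for the right module structure: its underlying object is the value at $\mathbf 1_{\mathcal A}$ of the right adjoint of $c\mapsto\mathbf 1_{\mathcal A}\cdot c$, and its multiplication is the composition of internal endomorphisms. Let $\mathcal O_{\mathcal A}:=T(\underline{\mathrm{End}}_{\mathcal A\boxtimes\mathcal A}(\mathbf 1_{\mathcal A}))$, an algebra in $\mathcal A$, and let $\mathcal O_{\mathcal A}\text{-mod}_{\mathcal A}$ be the category of left $\mathcal O_{\mathcal A}$-modules in $\mathcal A$. The relative tensor product $\mathcal A\boxtimes_{\mathcal A\boxtimes\mathcal A}\mathcal A$ is the target, in $\mathrm{LFP}_k$, of a compactness-preserving universal $(\mathcal A\boxtimes\mathcal A)$-balanced functor out of $\mathcal A\times\mathcal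 A$. Here a balanced functor is a functor $F$, $k$-linear and cocontinuous in each variable, with natural isomorphisms $F(a\cdot c,b)\cong F(a,c\cdot b)$ compatible with the associativity and unit constraints. Universality means that, for every $\mathcal E\in\mathrm{LFP}_k$, composition with it is an equivalence from the category of $k$-linear cocontinuous functors to $\mathcal E$ to the category of balanced functors to $\mathcal E$. Then there is an equivalence of categories $$\mathcal A\boxtimes_{\mathcal A\boxtimes\mathcal A}\mathcal A\;\simeq\;\mathcal O_{\mathcal A}\text{-mod}_{\mathcal A}.$$ More precisely, $\mathcal O_{\mathcal A}\text{-mod}_{\mathcal A}$ is the target of such a universal balanced functor (in particular the relative tensor product exists), and every relative tensor product $\mathcal A\boxtimes_{\mathcal A\boxtimes\mathcal A}\mathcal A$ is equivalent to $\mathcal O_{\mathcal A}\text{-mod}_{\mathcal A}$ as a $k$-linear category. -/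

import Mathlib

open CategoryTheory CategoryTheory.Limits CategoryTheory.MonoidalCategory

universe v

namespace LinearLFP

/-! ### `k`-linear locally finitely presentable categories and cocontinuous functors -/

section Functors

variable (k : Type v) [Field k]
variable {C D E P : Type (v + 1)}
  [Category.{v} C] [Preadditive C] [Linear k C]
  [Category.{v} D] [Preadditive D] [Linear k D]
  [Category.{v} E] [Preadditive E] [Linear k E]
  [Category.{v} P] [Preadditive P] [Linear k P]

/-- The 1-morphisms of the 2-category of `k`-linear locally finitely presentable categories:
`k`-linear functors which preserve all small colimits. -/
structure IsCocontinuous (F : C ⥤ D) : Prop where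
  additive : F.Additive
  linear : F.Linear k
  preservesColimits : PreservesColimitsOfSize.{v, v} F

variable (C D) in
/-- The category of `k`-linear cocontinuous functors and natural transformations. -/
abbrev CocontinuousFunctor :=
  ObjectProperty.FullSubcategory (fun F : C ⥤ D => IsCocontinuous k F)

/-- A bifunctor `C × D → E` (in curried form) that is `k`-linear and cocontinuous in each variable
separately. -/
structure IsBicocontinuous (F : C ⥤ D ⥤ E) : Prop where
  left (d : D) : IsCocontinuous k (F.flip.obj d)
  right (c : C) : IsCocontinuous k (F.obj c)

variable (C D E) in
/-- The category of `k`-bilinear bifunctors, cocontinuous in each variable. -/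
abbrev BicocontinuousFunctor :=
  ObjectProperty.FullSubcategory (fun F : C ⥤ D ⥤ E => IsBicocontinuous k F)

/-- A bifunctor is quasi-proper if it sends pairs of compact (that is, finitely presentable)
objects to compact objects. -/
def IsQuasiProper (F : C ⥤ D ⥤ E) : Prop :=
  ∀ (c : C) (d : D), IsFinitelyPresentable.{v} c → IsFinitelyPresentable.{v} d →
    IsFinitelyPresentable.{v} ((F.obj c).obj d)

variable {k}

theorem IsCocontinuous.comp {F : C ⥤ D} {G : D ⥤ E} (hF : IsCocontinuous k F)
    (hG : IsCocontinuous k G) : IsCocontinuous k (F ⋙ G) := by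
  have := hF.additive
  have := hG.additive
  have := hF.linear
  have := hG.linear
  have := hF.preservesColimits
  have := hG.preservesColimits
  exact ⟨inferInstance, inferInstance, inferInstance⟩

theorem IsBicocontinuous.comp {F : C ⥤ D ⥤ P} {L : P ⥤ E} (hF : IsBicocontinuous k F)
    (hL : IsCocontinuous k L) :
    IsBicocontinuous k (F ⋙ (Functor.whiskeringRight D P E).obj L) :=
  ⟨fun d => (hF.left d).comp hL, fun c => (hF.right c).comp hL⟩

/-- Composition of a bifunctor `B : C × D → P` with cocontinuous functors `P → E`. -/
def BicocontinuousFunctor.postcomp (B : BicocontinuousFunctor k C D P) (E : Type (v + 1))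
    [Category.{v} E] [Preadditive E] [Linear k E] :
    CocontinuousFunctor k P E ⥤ BicocontinuousFunctor k C D E :=
  ObjectProperty.lift _
    (ObjectProperty.ι _ ⋙ Functor.whiskeringRight D P E ⋙
      (Functor.whiskeringLeft C (D ⥤ P) (D ⥤ E)).obj B.obj)
    (fun L => B.property.comp L.property)

variable (k) in
/-- `B : C × D → P` exhibits `P` as the Deligne-Kelly tensor product `C ⊠ D` of `k`-linear locally
finitely presentable categories: `B` is the universal bifunctor which is `k`-linear and cocontinuous
in each variable. -/
structure IsKellyTensorProduct (B : C ⥤ D ⥤ P) : Prop where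
  locallyFinitelyPresentable : IsLocallyFinitelyPresentable.{v} P
  isBicocontinuous : IsBicocontinuous k B
  isQuasiProper : IsQuasiProper B
  universal : ∀ (E : Type (v + 1)) [Category.{v} E] [Preadditive E] [Linear k E]
    [IsLocallyFinitelyPresentable.{v} E],
    (BicocontinuousFunctor.postcomp (⟨B, isBicocontinuous⟩ : BicocontinuousFunctor k C D P)
      E).IsEquivalence

attribute [local instance] Cardinal.fact_isRegular_aleph0 in
/-- A cocontinuous functor out of a locally finitely presentable category has a right adjoint. -/
theorem IsCocontinuous.isLeftAdjoint [IsLocallyFinitelyPresentable.{v} C] {F : C ⥤ D}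
    (hF : IsCocontinuous k F) : F.IsLeftAdjoint := by
  have := hF.preservesColimits
  obtain ⟨P, _, hP⟩ :=
    HasCardinalFilteredGenerator.exists_small_generator C Cardinal.aleph0.{v}
  have : HasColimits C := inferInstanceAs (HasColimitsOfSize.{v, v} C)
  have := preservesLimitsOfSize_op.{v, v} F
  have h : F.op.IsRightAdjoint := by
    refine isRightAdjoint_of_preservesLimits_of_solutionSetCondition F.op fun X => ?_
    let J := CostructuredArrow (P.ι ⋙ F) X.unop
    have : HasColimitsOfShape J C :=
      hasColimitsOfShape_of_equivalence (equivSmallModel.{v} J).symm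
    have : PreservesColimitsOfShape J F :=
      preservesColimitsOfShape_of_equiv (equivSmallModel.{v} J).symm F
    let K : J ⥤ C := CostructuredArrow.proj (P.ι ⋙ F) X.unop ⋙ P.ι
    let c : Cocone (K ⋙ F) :=
      { pt := X.unop
        ι := { app := fun j => j.hom
               naturality := fun i j f => (CostructuredArrow.w f).trans (Category.comp_id _).symm } }
    let hK := isColimitOfPreserves F (colimit.isColimit K)
    refine ⟨PUnit, fun _ => Opposite.op (colimit K), fun _ => (hK.desc c).op, fun Y f => ?_⟩
    refine ⟨⟨⟩, ?_⟩
    obtain ⟨I, _, _, ⟨p⟩⟩ := hP.exists_colimitsOfShape Y.unop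
    let j (i : I) : J := CostructuredArrow.mk (S := P.ι ⋙ F) (Y := ⟨p.diag.obj i, p.prop_diag_obj i⟩)
      (F.map (p.ι.app i) ≫ f.unop)
    let d : Cocone p.diag :=
      { pt := colimit K
        ι := { app := fun i => colimit.ι K (j i)
               naturality := fun i i' g => by
                let u : j i ⟶ j i' := CostructuredArrow.homMk (ObjectProperty.homMk (p.diag.map g)) (by
                  simp [j, ← F.map_comp_assoc])
                exact (colimit.w K u).trans (Category.comp_id _).symm } }
    refine ⟨(p.isColimit.desc d).op, Quiver.Hom.unop_inj ?_⟩
    refine (isColimitOfPreserves F p.isColimit).hom_ext fun i => ?_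
    have h1 := p.isColimit.fac d i
    have h2 := hK.fac c (j i)
    dsimp at h1 h2 ⊢
    rw [← F.map_comp_assoc, h1]
    exact h2
  exact ⟨_, ⟨(Adjunction.ofIsRightAdjoint F.op).unop⟩⟩

/-- A cocontinuous functor out of a Deligne-Kelly tensor product has a right adjoint. -/
theorem IsKellyTensorProduct.isLeftAdjoint {B : C ⥤ D ⥤ P} (hB : IsKellyTensorProduct k B)
    {L : P ⥤ E} (hL : IsCocontinuous k L) : L.IsLeftAdjoint :=
  have := hB.locallyFinitelyPresentable
  hL.isLeftAdjoint

end Functors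

/-! ### Tensor categories -/

section Tensor

/-- A monoidal structure whose tensor product preserves colimits in each variable. Together with
`MonoidalLinear k A`, this says that `A` is an algebra for the Deligne-Kelly tensor product. -/
class IsMonoidalCocontinuous (A : Type (v + 1)) [Category.{v} A] [MonoidalCategory A] : Prop where
  preservesColimits_tensorLeft (X : A) : PreservesColimitsOfSize.{v, v} (tensorLeft X)
  preservesColimits_tensorRight (X : A) : PreservesColimitsOfSize.{v, v} (tensorRight X)

/-- A (large) tensor category, that is, up to equivalence the ind-completion of an essentially small
finitely cocomplete rigid monoidal category with right exact tensor product: a locally finitely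
presentable category with a cocontinuous monoidal structure, in which the compact (that is, finitely
presentable) objects are closed under tensor products, contain the unit, and all have left and
right duals. -/
class IsTensorCategory (A : Type (v + 1)) [Category.{v} A] [MonoidalCategory A] : Prop extends
    IsMonoidalCocontinuous A where
  locallyFinitelyPresentable : IsLocallyFinitelyPresentable.{v} A
  compact_unit : IsFinitelyPresentable.{v} (𝟙_ A)
  compact_tensor (X Y : A) : IsFinitelyPresentable.{v} X → IsFinitelyPresentable.{v} Y →
    IsFinitelyPresentable.{v} (X ⊗ Y)
  hasLeftDual (X : A) : IsFinitelyPresentable.{v} X → Nonempty (HasLeftDual X)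
  hasRightDual (X : A) : IsFinitelyPresentable.{v} X → Nonempty (HasRightDual X)

end Tensor

/-! ### Balanced functors and the relative tensor product -/

section Balanced

open MonoidalLeftAction MonoidalRightAction

variable (k : Type v) [Field k]
  (C : Type (v + 1)) [Category.{v} C] [MonoidalCategory C]
  (M : Type (v + 1)) [Category.{v} M] [Preadditive M] [Linear k M] [MonoidalRightAction C M]
  (N : Type (v + 1)) [Category.{v} N] [Preadditive N] [Linear k N] [MonoidalLeftAction C N]
  (E : Type (v + 1)) [Category.{v} E] [Preadditive E] [Linear k E]

/-- A `C`-balanced functor `M × N → E`, for a right `C`-module category `M` and a left `C`-module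
category `N`: a bilinear bicocontinuous functor `F` with natural isomorphisms
`F (m ⊙ c, n) ≅ F (m, c ⊙ n)` that are compatible with the associativity and unit constraints. -/
structure BalancedFunctor where
  functor : M ⥤ N ⥤ E
  isBicocontinuous : IsBicocontinuous k functor
  balancing (m : M) (c : C) (n : N) :
    (functor.obj (m ⊙ᵣ c)).obj n ≅ (functor.obj m).obj (c ⊙ₗ n)
  naturality_left {m m' : M} (f : m ⟶ m') (c : C) (n : N) :
    (functor.map (f ⊵ᵣ c)).app n ≫ (balancing m' c n).hom =
      (balancing m c n).hom ≫ (functor.map f).app (c ⊙ₗ n)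
  naturality_middle (m : M) {c c' : C} (f : c ⟶ c') (n : N) :
    (functor.map (m ⊴ᵣ f)).app n ≫ (balancing m c' n).hom =
      (balancing m c n).hom ≫ (functor.obj m).map (f ⊵ₗ n)
  naturality_right (m : M) (c : C) {n n' : N} (f : n ⟶ n') :
    (functor.obj (m ⊙ᵣ c)).map f ≫ (balancing m c n').hom =
      (balancing m c n).hom ≫ (functor.obj m).map (c ⊴ₗ f)
  associativity (m : M) (c c' : C) (n : N) :
    (functor.map (αᵣ m c c').hom).app n ≫ (balancing (m ⊙ᵣ c) c' n).hom ≫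
        (balancing m c (c' ⊙ₗ n)).hom =
      (balancing m (c ⊗ c') n).hom ≫ (functor.obj m).map (αₗ c c' n).hom
  unitality (m : M) (n : N) :
    (balancing m (𝟙_ C) n).hom ≫ (functor.obj m).map (λₗ n).hom =
      (functor.map (ρᵣ m).hom).app n

namespace BalancedFunctor

variable {k C M N E}

/-- Morphisms of balanced functors: natural transformations compatible with the balancings. -/
@[ext]
structure Hom (F G : BalancedFunctor k C M N E) where
  natTrans : F.functor ⟶ G.functor
  comm (m : M) (c : C) (n : N) :
    (natTrans.app (m ⊙ᵣ c)).app n ≫ (G.balancing m c n).hom =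
      (F.balancing m c n).hom ≫ (natTrans.app m).app (c ⊙ₗ n)

instance : Category (BalancedFunctor k C M N E) where
  Hom := Hom
  id F := ⟨𝟙 _, by simp⟩
  comp f g := ⟨f.natTrans ≫ g.natTrans, fun m c n => by
    simp [g.comm, reassoc_of% f.comm]⟩
  id_comp f := Hom.ext (Category.id_comp _)
  comp_id f := Hom.ext (Category.comp_id _)
  assoc f g h := Hom.ext (Category.assoc _ _ _)

/-- Composition of a balanced functor `B : M × N → P` with cocontinuous functors `P → E`. -/
def postcomp {P : Type (v + 1)} [Category.{v} P] [Preadditive P] [Linear k P]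
    (B : BalancedFunctor k C M N P) (E : Type (v + 1)) [Category.{v} E] [Preadditive E]
    [Linear k E] : CocontinuousFunctor k P E ⥤ BalancedFunctor k C M N E where
  obj L :=
    { functor := B.functor ⋙ (Functor.whiskeringRight N P E).obj L.obj
      isBicocontinuous := B.isBicocontinuous.comp L.property
      balancing := fun m c n => L.obj.mapIso (B.balancing m c n)
      naturality_left := fun f c n => by
        simpa using congrArg L.obj.map (B.naturality_left f c n)
      naturality_middle := fun m _ _ f n => by
        simpa using congrArg L.obj.map (B.naturality_middle m f n)
      naturality_right := fun m c _ _ f => by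
        simpa using congrArg L.obj.map (B.naturality_right m c f)
      associativity := fun m c c' n => by
        simpa using congrArg L.obj.map (B.associativity m c c' n)
      unitality := fun m n => by
        simpa using congrArg L.obj.map (B.unitality m n) }
  map τ :=
    { natTrans := Functor.whiskerLeft B.functor ((Functor.whiskeringRight N P E).map τ.hom)
      comm := fun m c n => by simp }
  map_id L := Hom.ext (by ext; simp; rfl)
  map_comp f g := Hom.ext (by ext; simp; rfl)

/-- `B : M × N → P` exhibits `P` as the relative Kelly tensor product `M ⊠_C N`: it is the universal
`C`-balanced functor out of `M × N`. -/
structure IsRelativeTensorProduct {P : Type (v + 1)} [Category.{v} P] [Preadditive P] [Linear k P]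
    (B : BalancedFunctor k C M N P) : Prop where
  locallyFinitelyPresentable : IsLocallyFinitelyPresentable.{v} P
  isQuasiProper : IsQuasiProper B.functor
  universal : ∀ (E : Type (v + 1)) [Category.{v} E] [Preadditive E] [Linear k E]
    [IsLocallyFinitelyPresentable.{v} E], (B.postcomp E).IsEquivalence

end BalancedFunctor

end Balanced

/-! ### Internal endomorphism algebras -/

section InternalEnd

open MonoidalRightAction

variable (C : Type (v + 1)) [Category.{v} C] [MonoidalCategory C]
  {M : Type (v + 1)} [Category.{v} M] [MonoidalRightAction C M]
  (m : M) [(actionLeft C m).IsLeftAdjoint]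

/-- The internal hom `Hom(m, -) : M ⥤ C`, the right adjoint of the action functor `c ↦ m ⊙ c`. -/
noncomputable abbrev internalHom : M ⥤ C := (actionLeft C m).rightAdjoint

/-- The evaluation `m ⊙ Hom(m, n) ⟶ n`. -/
noncomputable def internalEval (n : M) : m ⊙ᵣ ((internalHom C m).obj n) ⟶ n :=
  (Adjunction.ofIsLeftAdjoint (actionLeft C m)).counit.app n

variable {C m} in
/-- The morphism `c ⟶ Hom(m, n)` that corresponds to `m ⊙ c ⟶ n`. -/
noncomputable def internalCurry {c : C} {n : M} (f : m ⊙ᵣ c ⟶ n) : c ⟶ (internalHom C m).obj n :=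
  (Adjunction.ofIsLeftAdjoint (actionLeft C m)).homEquiv c n f

variable {C m} in
theorem internalCurry_eval {c : C} {n : M} (f : m ⊙ᵣ c ⟶ n) :
    m ⊴ᵣ (internalCurry f) ≫ internalEval C m n = f :=
  ((Adjunction.ofIsLeftAdjoint (actionLeft C m)).homEquiv_counit ..).symm.trans
    (((Adjunction.ofIsLeftAdjoint (actionLeft C m)).homEquiv c n).symm_apply_apply f)

variable {C m} in
theorem internalHom_ext {c : C} {n : M} {f g : c ⟶ (internalHom C m).obj n}
    (h : m ⊴ᵣ f ≫ internalEval C m n = m ⊴ᵣ g ≫ internalEval C m n) : f = g :=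
  ((Adjunction.ofIsLeftAdjoint (actionLeft C m)).homEquiv c n).symm.injective <| by
    rw [Adjunction.homEquiv_counit, Adjunction.homEquiv_counit]
    exact h

/-- The algebra of internal endomorphisms of `m`. The multiplication corresponds to
`m ⊙ (Hom(m, m) ⊗ Hom(m, m)) ≅ (m ⊙ Hom(m, m)) ⊙ Hom(m, m) ⟶ m ⊙ Hom(m, m) ⟶ m`. -/
noncomputable def internalEnd : Mon C where
  X := (internalHom C m).obj m
  mon :=
    { one := internalCurry (ρᵣ m).hom
      mul := internalCurry ((αᵣ m _ _).hom ≫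
        internalEval C m m ⊵ᵣ (internalHom C m).obj m ≫ internalEval C m m)
      one_mul := by
        apply internalHom_ext
        rw [actionHomRight_comp, Category.assoc, internalCurry_eval, actionHomRight_whiskerRight]
        simp only [Category.assoc, Iso.inv_hom_id_assoc]
        rw [← comp_actionHomLeft_assoc, internalCurry_eval, actionHom_leftUnitor, Category.assoc]
      mul_one := by
        apply internalHom_ext
        rw [actionHomRight_comp, Category.assoc, internalCurry_eval, whiskerRight_actionHomLeft]
        simp only [Category.assoc, Iso.inv_hom_id_assoc]
        rw [action_exchange_assoc, internalCurry_eval, actionHom_rightUnitor,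
          unit_actionHomRight]
        simp
      mul_assoc := by
        apply internalHom_ext
        rw [actionHomRight_comp, Category.assoc, internalCurry_eval, actionHomRight_whiskerRight]
        simp only [Category.assoc, Iso.inv_hom_id_assoc]
        rw [← comp_actionHomLeft_assoc, internalCurry_eval, actionHomRight_comp,
          actionHomRight_comp, Category.assoc, Category.assoc, internalCurry_eval,
          whiskerRight_actionHomLeft]
        simp only [Category.assoc, Iso.inv_hom_id_assoc]
        rw [action_exchange_assoc, internalCurry_eval, actionHomLeft_tensor]
        simp only [Category.assoc, Iso.inv_hom_id_assoc, comp_actionHomLeft]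
        rw [actionHom_associator_assoc] }

end InternalEnd

/-! ### Restriction along a monoidal functor -/

section Restriction

open Functor.Monoidal Functor.LaxMonoidal Functor.OplaxMonoidal

variable {S A : Type (v + 1)} [Category.{v} S] [MonoidalCategory S] [Category.{v} A]
  [MonoidalCategory A]

/-- The right action `a ⊙ s = a ⊗ T s` of `S` on `A` through a monoidal functor `T : S ⥤ A`. -/
@[reducible]
def rightActionOf (T : S ⥤ A) [T.Monoidal] : MonoidalRightAction S A where
  actionObj a s := a ⊗ T.obj s
  actionHomRight a _ _ f := a ◁ T.map f
  actionHomLeft f s := f ▷ T.obj s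
  actionHom f g := f ⊗ₘ T.map g
  actionAssocIso a s t := whiskerLeftIso a (μIso T s t).symm ≪≫ (α_ a _ _).symm
  actionUnitIso a := whiskerLeftIso a (εIso T).symm ≪≫ ρ_ a
  actionHom_def f g := by simp [MonoidalCategory.tensorHom_def]
  actionHomRight_id := by simp
  id_actionHomLeft := by simp
  actionHom_comp := by simp
  actionAssocIso_hom_naturality f g h := by
    simp only [Iso.trans_hom, whiskerLeftIso_hom, Iso.symm_hom, μIso_inv, Category.assoc,
      ← associator_inv_naturality]
    simp only [← id_tensorHom, tensorHom_comp_tensorHom_assoc, δ_natural, Category.comp_id,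
      Category.id_comp]
  actionUnitIso_hom_naturality f := by
    simp only [Iso.trans_hom, whiskerLeftIso_hom, Iso.symm_hom, εIso_inv, Category.assoc,
      ← rightUnitor_naturality, whisker_exchange_assoc]
  actionHomRight_whiskerRight f c d := by
    simp [← MonoidalCategory.whiskerLeft_comp]
  whiskerRight_actionHomLeft c _ _ f d := by
    simp [← MonoidalCategory.whiskerLeft_comp]
  actionHom_associator c₁ c₂ c₃ d := by
    have h := congrArg (fun t => d ◁ t) (Functor.OplaxMonoidal.associativity T c₁ c₂ c₃)
    simp only [MonoidalCategory.whiskerLeft_comp] at h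
    simp
    rw [← reassoc_of% h]
    simp
  actionHom_leftUnitor c d := by
    rw [← Functor.OplaxMonoidal.left_unitality_hom]
    simp only [MonoidalCategory.whiskerLeft_comp, Iso.trans_hom, whiskerLeftIso_hom, Iso.symm_hom,
      μIso_inv, εIso_inv, comp_whiskerRight, Category.assoc, whisker_assoc, Iso.inv_hom_id_assoc,
      triangle_assoc_comp_right]
  actionHom_rightUnitor c d := by
    rw [← Functor.OplaxMonoidal.right_unitality_hom]
    simp only [MonoidalCategory.whiskerLeft_comp, Iso.trans_hom, whiskerLeftIso_hom, Iso.symm_hom,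
      μIso_inv, εIso_inv, Category.assoc]
    monoidal

/-- The left action `s ⊙ a = T s ⊗ a` of `S` on `A` through a monoidal functor `T : S ⥤ A`. -/
@[reducible]
def leftActionOf (T : S ⥤ A) [T.Monoidal] : MonoidalLeftAction S A where
  actionObj s a := T.obj s ⊗ a
  actionHomLeft f a := T.map f ▷ a
  actionHomRight s _ _ f := T.obj s ◁ f
  actionHom f g := T.map f ⊗ₘ g
  actionAssocIso s t a := whiskerRightIso (μIso T s t).symm a ≪≫ α_ _ _ a
  actionUnitIso a := whiskerRightIso (εIso T).symm a ≪≫ λ_ a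
  actionHom_def f g := by simp [MonoidalCategory.tensorHom_def]
  actionHomRight_id := by simp
  id_actionHomLeft := by simp
  actionHom_comp := by simp
  actionAssocIso_hom_naturality f g h := by
    simp only [Iso.trans_hom, whiskerRightIso_hom, Iso.symm_hom, μIso_inv, Category.assoc,
      ← associator_naturality]
    simp only [← tensorHom_id, tensorHom_comp_tensorHom_assoc, δ_natural, Category.comp_id,
      Category.id_comp]
  actionUnitIso_hom_naturality f := by
    simp only [Iso.trans_hom, whiskerRightIso_hom, Iso.symm_hom, εIso_inv, Category.assoc,
      ← leftUnitor_naturality, whisker_exchange_assoc]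
  whiskerLeft_actionHomLeft c _ _ f d := by
    have h := congrArg (fun t => t ▷ d) (Functor.OplaxMonoidal.δ_natural_right T c f)
    simp only [comp_whiskerRight] at h
    rw [← Category.assoc, Iso.eq_comp_inv]
    simp only [Iso.trans_hom, whiskerRightIso_hom, Iso.symm_hom, μIso_inv, Category.assoc,
      ← reassoc_of% h]
    monoidal
  whiskerRight_actionHomLeft c f d := by
    simp [← comp_whiskerRight]
  associator_actionHom c₁ c₂ c₃ d := by
    have h := congrArg (fun t => t ▷ d) (Functor.OplaxMonoidal.associativity T c₁ c₂ c₃)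
    simp only [comp_whiskerRight] at h
    simp only [Iso.trans_hom, whiskerRightIso_hom, Iso.symm_hom, μIso_inv, Category.assoc,
      MonoidalCategory.whiskerLeft_comp, whisker_assoc_symm, Iso.hom_inv_id_assoc]
    rw [← reassoc_of% h]
    monoidal
  leftUnitor_actionHom c d := by
    rw [← Functor.OplaxMonoidal.left_unitality_hom]
    simp only [comp_whiskerRight, Iso.trans_hom, whiskerRightIso_hom, Iso.symm_hom,
      μIso_inv, εIso_inv, Category.assoc]
    monoidal
  rightUnitor_actionHom c d := by
    rw [← Functor.OplaxMonoidal.right_unitality_hom]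
    simp only [comp_whiskerRight, MonoidalCategory.whiskerLeft_comp, Iso.trans_hom,
      whiskerRightIso_hom, Iso.symm_hom, μIso_inv, εIso_inv, Category.assoc]
    monoidal

/-- The category `A`, regarded as a right and as a left module category over `S` through a monoidal
functor `T : S ⥤ A`, with `a ⊙ s = a ⊗ T s` and `s ⊙ a = T s ⊗ a`. -/
@[nolint unusedArguments]
def RegularModule (_ : S ⥤ A) : Type (v + 1) := A

namespace RegularModule

variable (T : S ⥤ A)

instance : Category.{v} (RegularModule T) := inferInstanceAs (Category.{v} A)

instance [Preadditive A] : Preadditive (RegularModule T) := inferInstanceAs (Preadditive A)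

instance {k : Type v} [Field k] [Preadditive A] [Linear k A] : Linear k (RegularModule T) :=
  inferInstanceAs (Linear k A)

/-- An object of `A`, regarded as an object of the module category. -/
def of (a : A) : RegularModule T := a

variable [T.Monoidal]

instance : MonoidalRightAction S (RegularModule T) := rightActionOf (A := A) T

instance : MonoidalLeftAction S (RegularModule T) := leftActionOf (A := A) T

theorem isLeftAdjoint_actionLeft (hT : T.IsLeftAdjoint) :
    (MonoidalRightAction.actionLeft S (of T (𝟙_ A))).IsLeftAdjoint := by
  have : (T ⋙ tensorLeft (𝟙_ A)).IsLeftAdjoint :=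
    Functor.isLeftAdjoint_of_iso (F := T)
      (NatIso.ofComponents (fun s => (λ_ (T.obj s)).symm) (by simp))
  exact this

end RegularModule

/-- The algebra `T (End_S (1_A))` in `A`, where `T : S ⥤ A` is a monoidal functor with a right
adjoint and `S` acts on `A` through `T` from the right. -/
noncomputable def coendAlgebra (T : S ⥤ A) [T.Monoidal] (hT : T.IsLeftAdjoint) : Mon A :=
  have := RegularModule.isLeftAdjoint_actionLeft T hT
  T.mapMon.obj (internalEnd S (RegularModule.of T (𝟙_ A)))

end Restriction

/-! ### Linear structure on categories of modules -/

section Modules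

variable {A : Type (v + 1)} [Category.{v} A] [MonoidalCategory A] [Preadditive A]
  [MonoidalPreadditive A] {R : A} [MonObj R]

/-- The category of (left) modules over an algebra `R` in `A` is preadditive, with the addition of
morphisms of `A`. -/
instance : Preadditive (CategoryTheory.Mod A R) where
  homGroup X Y :=
    { add := fun f g => Mod.Hom.mk' (f.hom + g.hom)
        (by simp [MonoidalPreadditive.whiskerLeft_add])
      zero := Mod.Hom.mk' 0 (by simp)
      neg := fun f => Mod.Hom.mk' (-f.hom) (by
        have h : R ◁ (-f.hom) = -(R ◁ f.hom) := (tensorLeft R).map_neg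
        simp [h])
      sub := fun f g => Mod.Hom.mk' (f.hom - g.hom) (by
        have h : R ◁ (f.hom - g.hom) = R ◁ f.hom - R ◁ g.hom := (tensorLeft R).map_sub
        simp [h])
      nsmul := fun n f => Mod.Hom.mk' (n • f.hom) (by
        have h : R ◁ (n • f.hom) = n • (R ◁ f.hom) := (tensorLeft R).map_nsmul
        simp [h])
      zsmul := fun n f => Mod.Hom.mk' (n • f.hom) (by
        have h : R ◁ (n • f.hom) = n • (R ◁ f.hom) := (tensorLeft R).map_zsmul
        simp [h])
      sub_eq_add_neg := fun f g => Mod.hom_ext _ _ (sub_eq_add_neg f.hom g.hom)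
      nsmul_zero := fun f => Mod.hom_ext _ _ (zero_nsmul f.hom)
      nsmul_succ := fun n f => Mod.hom_ext _ _ (succ_nsmul f.hom n)
      zsmul_zero' := fun f => Mod.hom_ext _ _ (zero_zsmul f.hom)
      zsmul_succ' := fun n f => Mod.hom_ext _ _ (SubNegMonoid.zsmul_succ' n f.hom)
      zsmul_neg' := fun n f => Mod.hom_ext _ _ (SubNegMonoid.zsmul_neg' n f.hom)
      add_assoc := fun f g h => Mod.hom_ext _ _ (add_assoc f.hom g.hom h.hom)
      zero_add := fun f => Mod.hom_ext _ _ (zero_add f.hom)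
      add_zero := fun f => Mod.hom_ext _ _ (add_zero f.hom)
      neg_add_cancel := fun f => Mod.hom_ext _ _ (neg_add_cancel f.hom)
      add_comm := fun f g => Mod.hom_ext _ _ (add_comm f.hom g.hom) }
  add_comp _ _ _ f f' g := Mod.hom_ext _ _ (Preadditive.add_comp _ _ _ f.hom f'.hom g.hom)
  comp_add _ _ _ f g g' := Mod.hom_ext _ _ (Preadditive.comp_add _ _ _ f.hom g.hom g'.hom)

variable {k : Type v} [Field k] [Linear k A] [MonoidalLinear k A]

/-- The category of (left) modules over an algebra `R` in `A` is `k`-linear, with the scalar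
multiplication of morphisms of `A`. -/
instance : Linear k (CategoryTheory.Mod A R) where
  homModule X Y :=
    { smul := fun r f => Mod.Hom.mk' (r • f.hom) (by simp)
      one_smul := fun f => Mod.hom_ext _ _ (one_smul k f.hom)
      mul_smul := fun r s f => Mod.hom_ext _ _ (mul_smul r s f.hom)
      smul_zero := fun r => Mod.hom_ext _ _ (smul_zero r)
      smul_add := fun r f g => Mod.hom_ext _ _ (smul_add r f.hom g.hom)
      add_smul := fun r s f => Mod.hom_ext _ _ (add_smul r s f.hom)
      zero_smul := fun f => Mod.hom_ext _ _ (zero_smul k f.hom) }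
  smul_comp _ _ _ r f g := Mod.hom_ext _ _ (Linear.smul_comp _ _ _ r f.hom g.hom)
  comp_smul _ _ _ f r g := Mod.hom_ext _ _ (Linear.comp_smul _ _ _ f.hom r g.hom)

end Modules

end LinearLFP

set_option linter.unusedSectionVars false

namespace LinearLFP

section InternalHom

open MonoidalRightAction MonObj

variable {C : Type (v + 1)} [Category.{v} C] [MonoidalCategory C]
  {M : Type (v + 1)} [Category.{v} M] [MonoidalRightAction C M]
  (m : M) [(actionLeft C m).IsLeftAdjoint]

theorem internalEval_naturality {n n' : M} (f : n ⟶ n') :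
    m ⊴ᵣ ((internalHom C m).map f) ≫ internalEval C m n' = internalEval C m n ≫ f :=
  (Adjunction.ofIsLeftAdjoint (actionLeft C m)).counit.naturality f

/-- The lax module structure `Hom(m, n) ⊗ c ⟶ Hom(m, n ⊙ c)` of the internal hom. -/
noncomputable def internalHomTensor (n : M) (c : C) :
    (internalHom C m).obj n ⊗ c ⟶ (internalHom C m).obj (n ⊙ᵣ c) :=
  internalCurry ((αᵣ m _ c).hom ≫ internalEval C m n ⊵ᵣ c)

theorem internalHomTensor_eval (n : M) (c : C) :
    m ⊴ᵣ (internalHomTensor m n c) ≫ internalEval C m (n ⊙ᵣ c) =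
      (αᵣ m _ c).hom ≫ internalEval C m n ⊵ᵣ c :=
  internalCurry_eval _

theorem internalHomTensor_naturality_left {n n' : M} (f : n ⟶ n') (c : C) :
    (internalHom C m).map f ▷ c ≫ internalHomTensor m n' c =
      internalHomTensor m n c ≫ (internalHom C m).map (f ⊵ᵣ c) := by
  apply internalHom_ext
  simp only [actionHomRight_comp, Category.assoc, internalHomTensor_eval, internalEval_naturality,
    actionHomRight_whiskerRight, Iso.inv_hom_id_assoc, reassoc_of% internalHomTensor_eval,
    ← comp_actionHomLeft]

theorem internalHomTensor_naturality_right (n : M) {c c' : C} (g : c ⟶ c') :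
    (internalHom C m).obj n ◁ g ≫ internalHomTensor m n c' =
      internalHomTensor m n c ≫ (internalHom C m).map (n ⊴ᵣ g) := by
  apply internalHom_ext
  simp only [actionHomRight_comp, Category.assoc, internalHomTensor_eval, internalEval_naturality,
    whiskerRight_actionHomLeft, Iso.inv_hom_id_assoc, reassoc_of% internalHomTensor_eval,
    action_exchange]

theorem internalHomTensor_assoc (n : M) (c c' : C) :
    internalHomTensor m n c ▷ c' ≫ internalHomTensor m (n ⊙ᵣ c) c' =
      (α_ _ c c').hom ≫ internalHomTensor m n (c ⊗ c') ≫ (internalHom C m).map (αᵣ n c c').hom := by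
  apply internalHom_ext
  simp only [actionHomRight_comp, Category.assoc, internalHomTensor_eval, internalEval_naturality,
    actionHomRight_whiskerRight, Iso.inv_hom_id_assoc, reassoc_of% internalHomTensor_eval,
    ← comp_actionHomLeft]
  have h := actionAssocIso_hom_naturality (internalEval C m n) (𝟙 c) (𝟙 c')
  simp only [tensorHom_id, id_whiskerRight, actionHom_id] at h
  rw [h, comp_actionHomLeft, actionHom_associator_assoc]

theorem internalHomTensor_unit (n : M) :
    internalHomTensor m n (𝟙_ C) ≫ (internalHom C m).map (ρᵣ n).hom = (ρ_ _).hom := by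
  apply internalHom_ext
  simp only [actionHomRight_comp, Category.assoc, internalEval_naturality,
    reassoc_of% internalHomTensor_eval, actionHom_rightUnitor, ← actionUnitIso_hom_naturality]

theorem rightAction_coevaluation_evaluation (n : M) (c d : C) [ExactPairing d c] :
    (ρᵣ (n ⊙ᵣ c)).inv ≫ (n ⊙ᵣ c) ⊴ᵣ (η_ d c) ≫ (αᵣ (n ⊙ᵣ c) d c).hom ≫
      ((αᵣ n c d).inv ≫ n ⊴ᵣ (ε_ d c) ≫ (ρᵣ n).hom) ⊵ᵣ c = 𝟙 _ := by
  have h := congrArg (fun t => n ⊴ᵣ t) (ExactPairing.coevaluation_evaluation d c)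
  simp only [actionHomRight_comp, whiskerRight_actionHomLeft, actionHomRight_whiskerRight,
    Category.assoc, actionHom_rightUnitor] at h
  have h1 : n ⊴ᵣ (λ_ c).inv ≫ (αᵣ n (𝟙_ C) c).hom ≫ (ρᵣ n).hom ⊵ᵣ c = 𝟙 _ := by
    rw [← actionHom_leftUnitor, ← actionHomRight_comp, Iso.inv_hom_id, actionHomRight_id]
  have h2 : (αᵣ n c (d ⊗ c)).inv ≫ n ⊴ᵣ (α_ c d c).inv ≫ (αᵣ n (c ⊗ d) c).hom =
      (αᵣ (n ⊙ᵣ c) d c).hom ≫ (αᵣ n c d).inv ⊵ᵣ c := by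
    rw [Iso.inv_comp_eq, ← cancel_mono ((αᵣ n c d).hom ⊵ᵣ c)]
    simp only [Category.assoc, inv_hom_actionHomLeft, Category.comp_id]
    rw [← actionHom_associator, ← actionHomRight_comp_assoc, Iso.inv_hom_id]
    simp
  rw [← cancel_mono (αᵣ n (𝟙_ C) c).hom] at h
  simp only [Category.assoc, Iso.inv_hom_id, Category.comp_id, cancel_epi, reassoc_of% h2] at h
  rw [Iso.inv_comp_eq]
  simp only [comp_actionHomLeft]
  rw [reassoc_of% h, h1]

theorem isIso_internalHomTensor (n : M) (c d : C) [ExactPairing d c] :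
    IsIso (internalHomTensor m n c) := by
  refine ⟨(ρ_ _).inv ≫ _ ◁ (η_ d c) ≫ (α_ _ d c).inv ≫
    (internalHomTensor m (n ⊙ᵣ c) d ≫
      (internalHom C m).map ((αᵣ n c d).inv ≫ n ⊴ᵣ (ε_ d c) ≫ (ρᵣ n).hom)) ▷ c, ?_, ?_⟩
  · have h : internalHomTensor m n c ▷ d ≫ internalHomTensor m (n ⊙ᵣ c) d ≫
        (internalHom C m).map ((αᵣ n c d).inv ≫ n ⊴ᵣ (ε_ d c) ≫ (ρᵣ n).hom) =
        (α_ _ c d).hom ≫ _ ◁ (ε_ d c) ≫ (ρ_ _).hom := by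
      rw [reassoc_of% internalHomTensor_assoc, ← Functor.map_comp, Iso.hom_inv_id_assoc,
        Functor.map_comp, ← reassoc_of% internalHomTensor_naturality_right, internalHomTensor_unit]
    rw [rightUnitor_inv_naturality_assoc, ← whisker_exchange_assoc,
      associator_inv_naturality_left_assoc, ← comp_whiskerRight, h]
    have h2 := congrArg (fun t => (internalHom C m).obj n ◁ t)
      (ExactPairing.coevaluation_evaluation d c)
    simp only [MonoidalCategory.whiskerLeft_comp] at h2
    calc _ = (ρ_ _).inv ≫ (α_ _ _ _).hom ≫ ((internalHom C m).obj n ◁ c ◁ η_ d c ≫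
        (internalHom C m).obj n ◁ (α_ c d c).inv ≫ (internalHom C m).obj n ◁ ε_ d c ▷ c) ≫
        (α_ _ _ _).inv ≫ (ρ_ _).hom ▷ c := by monoidal
      _ = _ := by rw [h2]; monoidal
  · simp only [comp_whiskerRight, Category.assoc]
    rw [internalHomTensor_naturality_left, reassoc_of% internalHomTensor_assoc,
      Iso.inv_hom_id_assoc,
      reassoc_of% internalHomTensor_naturality_right, ← Functor.map_comp, ← Functor.map_comp]
    have h' : (ρ_ ((internalHom C m).obj (n ⊙ᵣ c))).inv ≫ internalHomTensor m (n ⊙ᵣ c) (𝟙_ C) =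
        (internalHom C m).map (ρᵣ (n ⊙ᵣ c)).inv := by
      rw [Iso.inv_comp_eq, ← internalHomTensor_unit (C := C) m (n ⊙ᵣ c), Category.assoc,
        ← Functor.map_comp, Iso.hom_inv_id, CategoryTheory.Functor.map_id, Category.comp_id]
    rw [reassoc_of% h', ← Functor.map_comp, rightAction_coevaluation_evaluation,
      CategoryTheory.Functor.map_id]

/-- The action of the internal endomorphism algebra on internal homs. -/
noncomputable def internalEndAct (n : M) :
    (internalHom C m).obj m ⊗ (internalHom C m).obj n ⟶ (internalHom C m).obj n :=
  internalHomTensor m m ((internalHom C m).obj n) ≫ (internalHom C m).map (internalEval C m n)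

theorem internalEndAct_eval (n : M) :
    m ⊴ᵣ (internalEndAct m n) ≫ internalEval C m n =
      (αᵣ m _ _).hom ≫ internalEval C m m ⊵ᵣ (internalHom C m).obj n ≫ internalEval C m n := by
  rw [internalEndAct, actionHomRight_comp, Category.assoc, internalEval_naturality,
    reassoc_of% internalHomTensor_eval]

theorem mul_internalEnd : (internalEnd C m).mon.mul = internalEndAct m m :=
  internalHom_ext ((internalCurry_eval _).trans (internalEndAct_eval m m).symm)

/-- The unit of the internal endomorphism algebra. -/
noncomputable def internalEndUnit : 𝟙_ C ⟶ (internalHom C m).obj m :=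
  internalCurry (ρᵣ m).hom

theorem one_internalEnd : (internalEnd C m).mon.one = internalEndUnit m := rfl

theorem internalEndUnit_eval :
    m ⊴ᵣ (internalEndUnit m) ≫ internalEval C m m = (ρᵣ m).hom :=
  internalCurry_eval _

theorem internalEndUnit_act (n : M) :
    internalEndUnit m ▷ (internalHom C m).obj n ≫ internalEndAct m n = (λ_ _).hom := by
  apply internalHom_ext
  rw [actionHomRight_comp, Category.assoc, internalEndAct_eval, actionHomRight_whiskerRight]
  simp only [Category.assoc, Iso.inv_hom_id_assoc]
  rw [← comp_actionHomLeft_assoc, internalEndUnit_eval, actionHom_leftUnitor, Category.assoc]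

theorem internalEndAct_naturality {n n' : M} (f : n ⟶ n') :
    internalEndAct m n ≫ (internalHom C m).map f =
      (internalHom C m).obj m ◁ (internalHom C m).map f ≫ internalEndAct m n' := by
  rw [internalEndAct, internalEndAct, Category.assoc, ← Functor.map_comp,
    ← internalEval_naturality, Functor.map_comp, reassoc_of% internalHomTensor_naturality_right]

theorem internalEndAct_internalHomTensor (n : M) (c : C) :
    internalEndAct m n ▷ c ≫ internalHomTensor m n c =
      (α_ _ _ _).hom ≫ (internalHom C m).obj m ◁ internalHomTensor m n c ≫
        internalEndAct m (n ⊙ᵣ c) := by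
  rw [internalEndAct, comp_whiskerRight, Category.assoc, internalHomTensor_naturality_left,
    reassoc_of% internalHomTensor_assoc, ← Functor.map_comp, ← internalHomTensor_eval,
    Functor.map_comp,
    internalEndAct, reassoc_of% internalHomTensor_naturality_right]

theorem internalEndMul_act (n : M) :
    internalEndAct m m ▷ (internalHom C m).obj n ≫ internalEndAct m n =
      (α_ _ _ _).hom ≫ (internalHom C m).obj m ◁ internalEndAct m n ≫ internalEndAct m n := by
  conv_lhs => rw [internalEndAct.eq_def m n]
  rw [reassoc_of% internalEndAct_internalHomTensor, internalEndAct_naturality,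
    ← MonoidalCategory.whiskerLeft_comp_assoc, ← internalEndAct.eq_def]

end InternalHom

section Algebras

variable {k : Type v} [Field k] {N : Type (v + 1)} [Category.{v} N] [Preadditive N] [Linear k N]
  (T : Monad N) [T.toFunctor.Additive] [T.toFunctor.Linear k]

/-- The category of algebras over a `k`-linear monad is `k`-linear. -/
instance algebraLinear : Linear k T.Algebra where
  homModule X Y :=
    { smul := fun r f => { f := r • f.f, h := by simp [T.toFunctor.map_smul] }
      one_smul := fun f => Monad.Algebra.Hom.ext (one_smul k f.f)
      mul_smul := fun r s f => Monad.Algebra.Hom.ext (mul_smul r s f.f)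
      smul_zero := fun r => Monad.Algebra.Hom.ext (smul_zero r)
      smul_add := fun r f g => Monad.Algebra.Hom.ext (smul_add r f.f g.f)
      add_smul := fun r s f => Monad.Algebra.Hom.ext (add_smul r s f.f)
      zero_smul := fun f => Monad.Algebra.Hom.ext (zero_smul k f.f) }
  smul_comp _ _ _ r f g := Monad.Algebra.Hom.ext (Linear.smul_comp _ _ _ r f.f g.f)
  comp_smul _ _ _ f r g := Monad.Algebra.Hom.ext (Linear.comp_smul _ _ _ f.f r g.f)

theorem isCocontinuous_forget [PreservesColimitsOfSize.{v, v} T.toFunctor]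
    [HasColimitsOfSize.{v, v} N] : IsCocontinuous k T.forget where
  additive := inferInstance
  linear := ⟨fun _ _ => rfl⟩
  preservesColimits := inferInstance

theorem isCocontinuous_of_comp_forget [PreservesColimitsOfSize.{v, v} T.toFunctor]
    {X : Type (v + 1)} [Category.{v} X] [Preadditive X] [Linear k X] {F : X ⥤ T.Algebra}
    (hF : IsCocontinuous k (F ⋙ T.forget)) : IsCocontinuous k F where
  additive := ⟨fun {_ _ f g} => Monad.Algebra.Hom.ext (hF.additive.map_add (f := f) (g := g))⟩
  linear := ⟨fun f r => Monad.Algebra.Hom.ext (hF.linear.map_smul f r)⟩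
  preservesColimits := by
    have := hF.preservesColimits
    exact preservesColimits_of_reflects_of_preserves F T.forget

end Algebras

section LocallyPresentable

variable {N : Type (v + 1)} [Category.{v} N]

theorem _root_.CategoryTheory.ObjectProperty.IsStrongGenerator.strictMap
    {D : Type (v + 1)} [Category.{v} D] {P : ObjectProperty N} (hP : P.IsStrongGenerator)
    {F : N ⥤ D} {G : D ⥤ N} (adj : F ⊣ G) [G.Faithful] [G.ReflectsIsomorphisms] :
    (P.strictMap F).IsStrongGenerator := by
  have := adj.isRightAdjoint
  rw [ObjectProperty.isStrongGenerator_iff]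
  refine ⟨fun X Y f g h => G.map_injective (hP.isSeparating _ _ fun p hp u => ?_),
    fun X Y i _ hi => ?_⟩
  · apply (adj.homEquiv _ _).symm.injective
    rw [adj.homEquiv_naturality_right_symm, adj.homEquiv_naturality_right_symm]
    exact h _ ⟨p, hp⟩ _
  · have : IsIso (G.map i) := hP.isIso_of_mono _ fun p hp u => by
      obtain ⟨w, hw⟩ := hi _ ⟨p, hp⟩ ((adj.homEquiv _ _).symm u)
      refine ⟨adj.homEquiv _ _ w, ?_⟩
      dsimp only at hw ⊢
      rw [← adj.homEquiv_naturality_right, hw, Equiv.apply_symm_apply]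
    exact isIso_of_reflects_iso i G

variable (T : Monad N)

theorem isFinitelyPresentable_free_obj [PreservesColimitsOfSize.{v, v} T.toFunctor]
    [HasColimitsOfSize.{v, v} N]
    (X : N) (hX : IsFinitelyPresentable.{v} X) : IsFinitelyPresentable.{v} (T.free.obj X) := by
  have := Cardinal.fact_isRegular_aleph0.{v}
  have : IsCardinalPresentable X Cardinal.aleph0.{v} := hX
  exact T.adj.isCardinalPresentable_leftAdjoint_obj Cardinal.aleph0.{v} X

theorem isLocallyFinitelyPresentable_algebra [PreservesColimitsOfSize.{v, v} T.toFunctor]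
    [IsLocallyFinitelyPresentable.{v} N] : IsLocallyFinitelyPresentable.{v} T.Algebra := by
  have := Cardinal.fact_isRegular_aleph0.{v}
  have : HasColimitsOfSize.{v, v} T.Algebra :=
    hasColimits_of_hasColimits_createsColimits T.forget
  obtain ⟨P, _, hP⟩ :=
    HasCardinalFilteredGenerator.exists_small_generator N Cardinal.aleph0.{v}
  rw [IsLocallyFinitelyPresentable, IsCardinalLocallyPresentable.iff_exists_isStrongGenerator]
  refine ⟨P.strictMap T.free, inferInstance, ?_, ?_⟩
  · exact hP.isStrongGenerator.strictMap T.adj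
  · rintro _ ⟨X, hX⟩
    exact isFinitelyPresentable_free_obj T X (hP.le_isCardinalPresentable _ hX)

end LocallyPresentable

section InternalEndMonad

open scoped MonoidalRightAction MonoidalLeftAction

variable (C : Type (v + 1)) [Category.{v} C] [MonoidalCategory C]
  {M : Type (v + 1)} [Category.{v} M] [MonoidalRightAction C M]
  (m : M) [(MonoidalRightAction.actionLeft C m).IsLeftAdjoint]

theorem act_internalEndUnit :
    (internalHom C m).obj m ◁ internalEndUnit m ≫ internalEndAct m m =
      (ρ_ ((internalHom C m).obj m)).hom := by
  have := (internalEnd C m).mon.mul_one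
  rwa [mul_internalEnd] at this

variable {N : Type (v + 1)} [Category.{v} N] [MonoidalLeftAction C N]

/-- The action of the internal endomorphism algebra on `Hom(m, n) ⊙ X`. -/
noncomputable def internalEndSMul (n : M) (X : N) :
    (internalHom C m).obj m ⊙ₗ (internalHom C m).obj n ⊙ₗ X ⟶ (internalHom C m).obj n ⊙ₗ X :=
  (αₗ _ _ X).inv ≫ internalEndAct m n ⊵ₗ X

theorem internalEndSMul_eq (n : M) (X : N) :
    internalEndSMul C m n X = ((αₗ _ _ X).inv ≫ internalHomTensor m m _ ⊵ₗ X) ≫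
      (internalHom C m).map (internalEval C m n) ⊵ₗ X := by
  rw [internalEndSMul, internalEndAct, MonoidalLeftAction.comp_actionHomLeft, Category.assoc]

theorem internalEndUnit_smul (n : M) (X : N) :
    (λₗ _).inv ≫ internalEndUnit m ⊵ₗ ((internalHom C m).obj n ⊙ₗ X) ≫ internalEndSMul C m n X =
      𝟙 _ := by
  have h := congrArg (fun t => t ⊵ₗ X) (internalEndUnit_act (C := C) m n)
  simp only [MonoidalLeftAction.comp_actionHomLeft, MonoidalLeftAction.whiskerRight_actionHomLeft,
    MonoidalLeftAction.leftUnitor_actionHom, Category.assoc, cancel_epi] at h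
  rw [internalEndSMul, h, Iso.inv_hom_id]

theorem internalEndSMul_assoc (n : M) (X : N) :
    internalEndSMul C m m ((internalHom C m).obj n ⊙ₗ X) ≫ internalEndSMul C m n X =
      (internalHom C m).obj m ⊴ₗ internalEndSMul C m n X ≫ internalEndSMul C m n X := by
  have h := congrArg (fun t => t ⊵ₗ X) (internalEndMul_act (C := C) m n)
  simp only [MonoidalLeftAction.comp_actionHomLeft, MonoidalLeftAction.whiskerRight_actionHomLeft,
    MonoidalLeftAction.whiskerLeft_actionHomLeft, Category.assoc] at h
  simp only [internalEndSMul, MonoidalLeftAction.actionHomRight_comp, Category.assoc]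
  rw [Iso.inv_comp_eq, ← cancel_epi (αₗ _ _ X).hom, h,
    ← MonoidalLeftAction.associator_actionHom_assoc]
  simp

theorem internalEndSMul_naturality (n : M) {X Y : N} (f : X ⟶ Y) :
    (internalHom C m).obj m ⊴ₗ (internalHom C m).obj n ⊴ₗ f ≫ internalEndSMul C m n Y =
      internalEndSMul C m n X ≫ (internalHom C m).obj n ⊴ₗ f := by
  simp [internalEndSMul, ← MonoidalLeftAction.action_exchange]

theorem internalEndSMul_naturality_left {n n' : M} (f : n ⟶ n') (X : N) :
    (internalHom C m).obj m ⊴ₗ (internalHom C m).map f ⊵ₗ X ≫ internalEndSMul C m n' X =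
      internalEndSMul C m n X ≫ (internalHom C m).map f ⊵ₗ X := by
  rw [internalEndSMul, internalEndSMul, Category.assoc, ← MonoidalLeftAction.comp_actionHomLeft,
    internalEndAct_naturality]
  simp

theorem internalEndSMul_unit (X : N) :
    (internalHom C m).obj m ⊴ₗ ((λₗ X).inv ≫ internalEndUnit m ⊵ₗ X) ≫ internalEndSMul C m m X =
      𝟙 _ := by
  have h := congrArg (fun t => t ⊵ₗ X) (act_internalEndUnit C m)
  simp only [MonoidalLeftAction.comp_actionHomLeft,
    MonoidalLeftAction.whiskerLeft_actionHomLeft, MonoidalLeftAction.rightUnitor_actionHom,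
    Category.assoc, cancel_epi] at h
  rw [MonoidalLeftAction.actionHomRight_comp, Category.assoc, internalEndSMul, h,
    ← MonoidalLeftAction.actionHomRight_comp, Iso.inv_hom_id, MonoidalLeftAction.actionHomRight_id]

variable (N) in
/-- The monad on a left module category given by the internal endomorphism algebra of `m`. -/
noncomputable def internalEndMonad : Monad N where
  toFunctor := (MonoidalLeftAction.curriedAction C N).obj ((internalHom C m).obj m)
  η :=
    { app := fun X => (λₗ X).inv ≫ internalEndUnit m ⊵ₗ X
      naturality := fun X Y f => by
        change f ≫ _ ≫ _ = (_ ≫ _) ≫ _ ⊴ₗ f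
        rw [Category.assoc, ← MonoidalLeftAction.action_exchange,
          MonoidalLeftAction.actionUnitIso_inv_naturality_assoc] }
  μ :=
    { app := fun X => internalEndSMul C m m X
      naturality := fun X Y f => internalEndSMul_naturality C m m f }
  assoc X := (internalEndSMul_assoc C m m X).symm
  left_unit X := (Category.assoc _ _ _).trans (internalEndUnit_smul C m m X)
  right_unit X := internalEndSMul_unit C m X

/-- The bifunctor `(n, X) ↦ Hom(m, n) ⊙ X` with values in modules over the internal endomorphism
algebra of `m`. -/
noncomputable def internalHomTensorFunctor : M ⥤ N ⥤ (internalEndMonad C m N).Algebra where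
  obj n :=
    { obj := fun X =>
        { A := (internalHom C m).obj n ⊙ₗ X
          a := internalEndSMul C m n X
          unit := (Category.assoc _ _ _).trans (internalEndUnit_smul C m n X)
          assoc := internalEndSMul_assoc C m n X }
      map := fun f =>
        { f := (internalHom C m).obj n ⊴ₗ f
          h := internalEndSMul_naturality C m n f }
      map_id := fun X => Monad.Algebra.Hom.ext (MonoidalLeftAction.actionHomRight_id _ _)
      map_comp := fun f g => Monad.Algebra.Hom.ext (MonoidalLeftAction.actionHomRight_comp _ f g) }
  map f :=
    { app := fun X =>
        { f := (internalHom C m).map f ⊵ₗ X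
          h := internalEndSMul_naturality_left C m f X }
      naturality := fun X Y g =>
        Monad.Algebra.Hom.ext (MonoidalLeftAction.action_exchange ((internalHom C m).map f) g) }
  map_id n := NatTrans.ext (funext fun X => Monad.Algebra.Hom.ext (by
    change (internalHom C m).map (𝟙 n) ⊵ₗ X = 𝟙 _
    rw [CategoryTheory.Functor.map_id, MonoidalLeftAction.id_actionHomLeft]))
  map_comp f g := NatTrans.ext (funext fun X => Monad.Algebra.Hom.ext (by
    change (internalHom C m).map (f ≫ g) ⊵ₗ X = (internalHom C m).map f ⊵ₗ X ≫
      (internalHom C m).map g ⊵ₗ X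
    rw [Functor.map_comp, MonoidalLeftAction.comp_actionHomLeft]))

/-- The comparison `Hom(m, n) ⊙ (c ⊙ X) ⟶ Hom(m, n ⊙ c) ⊙ X`. -/
noncomputable def internalHomBalancing (n : M) (c : C) (X : N) :
    (internalHom C m).obj n ⊙ₗ c ⊙ₗ X ⟶ (internalHom C m).obj (n ⊙ᵣ c) ⊙ₗ X :=
  (αₗ _ c X).inv ≫ internalHomTensor m n c ⊵ₗ X

instance isIso_internalHomBalancing (n : M) (c : C) (X : N) [IsIso (internalHomTensor m n c)] :
    IsIso (internalHomBalancing C m n c X) := by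
  unfold internalHomBalancing
  infer_instance

theorem internalHomBalancing_smul (n : M) (c : C) (X : N) :
    (internalHom C m).obj m ⊴ₗ internalHomBalancing C m n c X ≫ internalEndSMul C m (n ⊙ᵣ c) X =
      internalEndSMul C m n (c ⊙ₗ X) ≫ internalHomBalancing C m n c X := by
  have h := congrArg (fun t => t ⊵ₗ X) (internalEndAct_internalHomTensor (C := C) m n c)
  simp only [MonoidalLeftAction.comp_actionHomLeft, MonoidalLeftAction.whiskerRight_actionHomLeft,
    MonoidalLeftAction.whiskerLeft_actionHomLeft, Category.assoc] at h
  simp only [internalEndSMul, internalHomBalancing, MonoidalLeftAction.actionHomRight_comp,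
    Category.assoc]
  rw [← cancel_epi (αₗ _ _ (c ⊙ₗ X)).hom, Iso.hom_inv_id_assoc, ← cancel_epi (αₗ _ c X).hom, h,
    ← MonoidalLeftAction.associator_actionHom_assoc]
  simp

theorem internalHomBalancing_naturality_left {n n' : M} (f : n ⟶ n') (c : C) (X : N) :
    internalHomBalancing C m n c X ≫ (internalHom C m).map (f ⊵ᵣ c) ⊵ₗ X =
      (internalHom C m).map f ⊵ₗ (c ⊙ₗ X) ≫ internalHomBalancing C m n' c X := by
  rw [internalHomBalancing, internalHomBalancing, Category.assoc,
    ← MonoidalLeftAction.comp_actionHomLeft, ← internalHomTensor_naturality_left]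
  simp

theorem internalHomBalancing_naturality_middle (n : M) {c c' : C} (f : c ⟶ c') (X : N) :
    internalHomBalancing C m n c X ≫ (internalHom C m).map (n ⊴ᵣ f) ⊵ₗ X =
      (internalHom C m).obj n ⊴ₗ (f ⊵ₗ X) ≫ internalHomBalancing C m n c' X := by
  rw [internalHomBalancing, internalHomBalancing, Category.assoc,
    ← MonoidalLeftAction.comp_actionHomLeft, ← internalHomTensor_naturality_right]
  simp

theorem internalHomBalancing_naturality_right (n : M) (c : C) {X Y : N} (f : X ⟶ Y) :
    internalHomBalancing C m n c X ≫ (internalHom C m).obj (n ⊙ᵣ c) ⊴ₗ f =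
      (internalHom C m).obj n ⊴ₗ c ⊴ₗ f ≫ internalHomBalancing C m n c Y := by
  simp [internalHomBalancing, ← MonoidalLeftAction.action_exchange]

theorem internalHomBalancing_associativity (n : M) (c c' : C) (X : N) :
    internalHomBalancing C m n (c ⊗ c') X ≫ (internalHom C m).map (αᵣ n c c').hom ⊵ₗ X =
      ((internalHom C m).obj n ⊴ₗ (αₗ c c' X).hom ≫ internalHomBalancing C m n c (c' ⊙ₗ X)) ≫
        internalHomBalancing C m (n ⊙ᵣ c) c' X := by
  have h := congrArg (fun t => t ⊵ₗ X) (internalHomTensor_assoc (C := C) m n c c')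
  simp only [MonoidalLeftAction.comp_actionHomLeft, MonoidalLeftAction.whiskerRight_actionHomLeft,
    Category.assoc] at h
  simp only [internalHomBalancing, Category.assoc]
  rw [← cancel_epi (αₗ _ _ X).hom, Iso.hom_inv_id_assoc,
    ← cancel_epi ((α_ ((internalHom C m).obj n) c c').hom ⊵ₗ X), ← h,
    MonoidalLeftAction.associator_actionHom_assoc, Iso.hom_inv_id_assoc]

theorem internalHomBalancing_unitality (n : M) (X : N) :
    (internalHom C m).obj n ⊴ₗ (λₗ X).hom =
      internalHomBalancing C m n (𝟙_ C) X ≫ (internalHom C m).map (ρᵣ n).hom ⊵ₗ X := by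
  rw [internalHomBalancing, Category.assoc, ← MonoidalLeftAction.comp_actionHomLeft,
    internalHomTensor_unit]
  simp

/-- The isomorphism of modules `Hom(m, n) ⊙ (c ⊙ X) ≅ Hom(m, n ⊙ c) ⊙ X`. -/
noncomputable def internalHomBalancingIso [∀ n c, IsIso (internalHomTensor (C := C) m n c)]
    (n : M) (c : C) (X : N) :
    ((internalHomTensorFunctor C m).obj n).obj (c ⊙ₗ X) ≅
      ((internalHomTensorFunctor C m).obj (n ⊙ᵣ c)).obj X :=
  let e : (internalHom C m).obj n ⊙ₗ c ⊙ₗ X ≅ (internalHom C m).obj (n ⊙ᵣ c) ⊙ₗ X :=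
    asIso (internalHomBalancing C m n c X)
  Monad.Algebra.isoMk e (internalHomBalancing_smul C m n c X)

end InternalEndMonad

section PointwiseCoequalizer

variable {k : Type v} [Field k]
  {D : Type (v + 1)} [Category.{v} D] [Preadditive D] [Linear k D]
  {E : Type (v + 1)} [Category.{v} E] [Preadditive E] [Linear k E]

/-- A functor which is pointwise a coequalizer of cocontinuous functors is cocontinuous. -/
theorem isCocontinuous_of_isColimit_cofork {F G L : D ⥤ E} (hF : IsCocontinuous k F)
    (hG : IsCocontinuous k G) {p q : F ⟶ G} (π : G ⟶ L)
    (w : ∀ X, p.app X ≫ π.app X = q.app X ≫ π.app X)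
    (h : ∀ X, IsColimit (Cofork.ofπ (π.app X) (w X))) : IsCocontinuous k L := by
  have hπ (X : D) : Epi (π.app X) := ⟨fun f g hfg => Cofork.IsColimit.hom_ext (h X) hfg⟩
  have := hF.preservesColimits
  have := hG.preservesColimits
  have := hG.additive
  have := hG.linear
  refine ⟨⟨fun {X Y f g} => ?_⟩, ⟨fun {X Y} f r => ?_⟩,
    ⟨fun {J _} => ⟨fun {K} => ⟨fun {c} hc => ?_⟩⟩⟩⟩
  · rw [← cancel_epi (π.app X), ← π.naturality, Functor.map_add, Preadditive.add_comp,
      Preadditive.comp_add, π.naturality, π.naturality]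
  · rw [← cancel_epi (π.app X), ← π.naturality, Functor.map_smul, Linear.smul_comp,
      Linear.comp_smul, π.naturality]
  · have hGc := isColimitOfPreserves G hc
    have hFc := isColimitOfPreserves F hc
    let t (s : Cocone (K ⋙ L)) : Cocone (K ⋙ G) :=
      { pt := s.pt
        ι := { app := fun j => π.app (K.obj j) ≫ s.ι.app j
               naturality := fun i j f => by
                have := s.w f
                dsimp at this ⊢
                rw [π.naturality_assoc, this, Category.comp_id] } }
    have ht (s : Cocone (K ⋙ L)) : p.app c.pt ≫ hGc.desc (t s) = q.app c.pt ≫ hGc.desc (t s) := by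
      refine hFc.hom_ext fun j => ?_
      have hj := hGc.fac (t s) j
      dsimp [t] at hj ⊢
      rw [p.naturality_assoc, q.naturality_assoc, hj, reassoc_of% (w (K.obj j))]
    refine ⟨{
      desc := fun s => Cofork.IsColimit.desc (h c.pt) (hGc.desc (t s)) (ht s)
      fac := fun s j => ?_
      uniq := fun s f hf => ?_ }⟩
    · have hj := hGc.fac (t s) j
      have hd := Cofork.IsColimit.π_desc' (h c.pt) (hGc.desc (t s)) (ht s)
      dsimp [t] at hj hd ⊢
      rw [← cancel_epi (π.app (K.obj j)), ← π.naturality_assoc, hd, hj]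
    · rw [← cancel_epi (π.app c.pt)]
      have hd := Cofork.IsColimit.π_desc' (h c.pt) (hGc.desc (t s)) (ht s)
      dsimp at hd ⊢
      rw [hd]
      refine hGc.hom_ext fun j => ?_
      have hj := hGc.fac (t s) j
      have hfj := hf j
      dsimp [t] at hj hfj ⊢
      rw [hj, π.naturality_assoc, hfj]

end PointwiseCoequalizer

open scoped MonoidalRightAction MonoidalLeftAction

namespace BalancedFunctor

variable {k : Type v} [Field k]
  {C : Type (v + 1)} [Category.{v} C] [MonoidalCategory C]
  {M : Type (v + 1)} [Category.{v} M] [Preadditive M] [Linear k M] [MonoidalRightAction C M]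
  {N : Type (v + 1)} [Category.{v} N] [Preadditive N] [Linear k N] [MonoidalLeftAction C N]
  {E : Type (v + 1)} [Category.{v} E] [Preadditive E] [Linear k E]

/-- An isomorphism of balanced functors, from a morphism with invertible components. -/
noncomputable def isoOfComponents {F G : BalancedFunctor k C M N E} (σ : F ⟶ G)
    (h : ∀ n X, IsIso ((Hom.natTrans σ).app n |>.app X)) : F ≅ G :=
  have : ∀ n, IsIso ((Hom.natTrans σ).app n) := fun n => NatIso.isIso_of_isIso_app _
  have : IsIso (Hom.natTrans σ) := NatIso.isIso_of_isIso_app _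
  { hom := σ
    inv :=
      { natTrans := inv (Hom.natTrans σ)
        comm := fun m c n => by
          have := Hom.comm σ m c n
          simp only [NatIso.isIso_inv_app]
          rw [IsIso.inv_comp_eq, reassoc_of% this, IsIso.hom_inv_id, Category.comp_id] }
    hom_inv_id := Hom.ext (IsIso.hom_inv_id _)
    inv_hom_id := Hom.ext (IsIso.inv_hom_id _) }

section Extension

variable (m : M) [(MonoidalRightAction.actionLeft C m).IsLeftAdjoint]

/-- The morphism `G(m, Hom(m, n) ⊙ X) ≅ G(m ⊙ Hom(m, n), X) ⟶ G(n, X)`. -/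
noncomputable def evalMap (G : BalancedFunctor k C M N E) (n : M) (X : N) :
    (G.functor.obj m).obj ((internalHom C m).obj n ⊙ₗ X) ⟶ (G.functor.obj n).obj X :=
  (G.balancing m ((internalHom C m).obj n) X).inv ≫ (G.functor.map (internalEval C m n)).app X

variable (G : BalancedFunctor k C M N E)

theorem evalMap_naturality_left {n n' : M} (f : n ⟶ n') (X : N) :
    (G.functor.obj m).map ((internalHom C m).map f ⊵ₗ X) ≫ G.evalMap m n' X =
      G.evalMap m n X ≫ (G.functor.map f).app X := by
  rw [evalMap, evalMap, Category.assoc, ← NatTrans.comp_app, ← Functor.map_comp,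
    ← internalEval_naturality, Functor.map_comp, NatTrans.comp_app, ← Category.assoc,
    ← Category.assoc]
  congr 1
  rw [Iso.comp_inv_eq, Category.assoc, Iso.eq_inv_comp, G.naturality_middle]

theorem evalMap_naturality_right (n : M) {X Y : N} (f : X ⟶ Y) :
    (G.functor.obj m).map ((internalHom C m).obj n ⊴ₗ f) ≫ G.evalMap m n Y =
      G.evalMap m n X ≫ (G.functor.obj n).map f := by
  rw [evalMap, evalMap, Category.assoc, ← (G.functor.map (internalEval C m n)).naturality,
    ← Category.assoc, ← Category.assoc]
  congr 1
  rw [Iso.comp_inv_eq, Category.assoc, Iso.eq_inv_comp, G.naturality_right]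

theorem evalMap_balancing (n : M) (c : C) (X : N) :
    (G.functor.obj m).map ((αₗ _ c X).inv ≫ internalHomTensor m n c ⊵ₗ X) ≫
      G.evalMap m (n ⊙ᵣ c) X ≫ (G.balancing n c X).hom = G.evalMap m n (c ⊙ₗ X) := by
  have h1 := G.naturality_middle m (internalHomTensor m n c) X
  rw [← Iso.eq_comp_inv, Category.assoc, ← Iso.inv_comp_eq] at h1
  have h2 := congrArg (fun t => (G.functor.map t).app X) (internalHomTensor_eval m n c)
  simp only [Functor.map_comp, NatTrans.comp_app] at h2
  have h3 := G.associativity m ((internalHom C m).obj n) c X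
  have h4 := G.naturality_left (internalEval C m n) c X
  rw [Functor.map_comp, Category.assoc, evalMap, Category.assoc, ← reassoc_of% h1, reassoc_of% h2,
    h4, evalMap]
  have h5 : (G.functor.obj m).map (αₗ ((internalHom C m).obj n) c X).inv ≫
      (G.balancing m ((internalHom C m).obj n ⊗ c) X).inv =
      (G.balancing m ((internalHom C m).obj n) (c ⊙ₗ X)).inv ≫
        (G.balancing (m ⊙ᵣ (internalHom C m).obj n) c X).inv ≫
          (G.functor.map (αᵣ m ((internalHom C m).obj n) c).inv).app X := by
    rw [← cancel_epi ((G.functor.obj m).map (αₗ _ c X).hom), ← cancel_epi (G.balancing m _ X).hom]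
    trans 𝟙 _
    · simp
    · rw [← reassoc_of% h3, Iso.hom_inv_id_assoc, Iso.hom_inv_id_assoc, ← NatTrans.comp_app,
        ← Functor.map_comp, Iso.hom_inv_id]
      simp
  rw [reassoc_of% h5, ← NatTrans.comp_app_assoc, ← Functor.map_comp, Iso.inv_hom_id]
  simp

theorem evalMap_evalMap (n : M) (X : N) :
    G.evalMap m m ((internalHom C m).obj n ⊙ₗ X) ≫ G.evalMap m n X =
      (G.functor.obj m).map (internalEndSMul C m n X) ≫ G.evalMap m n X := by
  have h : (G.balancing m ((internalHom C m).obj n) X).hom ≫ G.evalMap m n X =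
      (G.functor.map (internalEval C m n)).app X := by
    rw [evalMap, Iso.hom_inv_id_assoc]
  rw [internalEndSMul_eq, Functor.map_comp, Category.assoc, evalMap_naturality_left,
    ← reassoc_of% evalMap_balancing, h]

/-- Morphisms of balanced functors are compatible with the evaluation maps. -/
theorem Hom.evalMap {G G' : BalancedFunctor k C M N E} (σ : G ⟶ G') (n : M) (X : N) :
    G.evalMap m n X ≫ ((Hom.natTrans σ).app n).app X =
      ((Hom.natTrans σ).app m).app _ ≫ G'.evalMap m n X := by
  have h1 := Hom.comm σ m ((internalHom C m).obj n) X
  have h2 := congrArg (fun t => t.app X) ((Hom.natTrans σ).naturality (internalEval C m n))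
  dsimp only [NatTrans.comp_app] at h2
  rw [BalancedFunctor.evalMap, BalancedFunctor.evalMap, Category.assoc, h2, Iso.inv_comp_eq,
    ← reassoc_of% h1, Iso.hom_inv_id_assoc]

variable (k N) in
/-- The balanced functor `(n, X) ↦ Hom(m, n) ⊙ X` into modules over the internal endomorphism
algebra of `m`. -/
noncomputable def internalHomBalanced [(internalEndMonad C m N).toFunctor.Additive]
    [(internalEndMonad C m N).toFunctor.Linear k]
    [∀ n c, IsIso (internalHomTensor (C := C) m n c)]
    (hN : IsBicocontinuous k (internalHomTensorFunctor C m (N := N))) :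
    BalancedFunctor k C M N (internalEndMonad C m N).Algebra where
  functor := internalHomTensorFunctor C m
  isBicocontinuous := hN
  balancing n c X := (internalHomBalancingIso C m n c X).symm
  naturality_left f c X := by
    rw [Iso.symm_hom, Iso.symm_hom, Iso.comp_inv_eq, Category.assoc, Iso.eq_inv_comp]
    exact Monad.Algebra.Hom.ext (internalHomBalancing_naturality_left C m f c X)
  naturality_middle n _ _ f X := by
    rw [Iso.symm_hom, Iso.symm_hom, Iso.comp_inv_eq, Category.assoc, Iso.eq_inv_comp]
    exact Monad.Algebra.Hom.ext (internalHomBalancing_naturality_middle C m n f X)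
  naturality_right n c _ _ f := by
    rw [Iso.symm_hom, Iso.symm_hom, Iso.comp_inv_eq, Category.assoc, Iso.eq_inv_comp]
    exact Monad.Algebra.Hom.ext (internalHomBalancing_naturality_right C m n c f)
  associativity n c c' X := by
    rw [Iso.symm_hom, Iso.symm_hom, Iso.symm_hom, Iso.eq_inv_comp, ← Category.assoc,
      ← Category.assoc, Iso.comp_inv_eq, Iso.comp_inv_eq]
    exact Monad.Algebra.Hom.ext (internalHomBalancing_associativity C m n c c' X)
  unitality n X := by
    rw [Iso.symm_hom, Iso.inv_comp_eq]
    exact Monad.Algebra.Hom.ext (internalHomBalancing_unitality C m n X)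

end Extension
end BalancedFunctor
open scoped MonoidalRightAction MonoidalLeftAction
namespace BalancedFunctor

variable {k : Type v} [Field k]
  {C : Type (v + 1)} [Category.{v} C] [MonoidalCategory C]
  {M : Type (v + 1)} [Category.{v} M] [Preadditive M] [Linear k M] [MonoidalRightAction C M]
  {N : Type (v + 1)} [Category.{v} N] [Preadditive N] [Linear k N] [MonoidalLeftAction C N]
  {E : Type (v + 1)} [Category.{v} E] [Preadditive E] [Linear k E]
  {m : M} [(MonoidalRightAction.actionLeft C m).IsLeftAdjoint]
  [(internalEndMonad C m N).toFunctor.Additive] [(internalEndMonad C m N).toFunctor.Linear k]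
  [∀ n c, IsIso (internalHomTensor (C := C) m n c)]
  (hN : IsBicocontinuous k (internalHomTensorFunctor C m (N := N)))

variable (C m) in
/-- The action of the internal endomorphism algebra on a module. -/
def moduleAct (X : (internalEndMonad C m N).Algebra) : (internalHom C m).obj m ⊙ₗ X.A ⟶ X.A :=
  X.a

/-- The canonical presentation `Hom(m, m) ⊙ X ⟶ X` of a module. -/
noncomputable def freeCover (X : (internalEndMonad C m N).Algebra) :
    ((internalHomBalanced k N m hN).functor.obj m).obj X.A ⟶ X :=
  Monad.FreeCoequalizer.π X

theorem freeCover_naturality {X Y : (internalEndMonad C m N).Algebra} (f : X ⟶ Y) :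
    ((internalHomBalanced k N m hN).functor.obj m).map f.f ≫ freeCover hN Y =
      freeCover hN X ≫ f := by
  apply Monad.Algebra.Hom.ext
  exact f.h

theorem evalMap_internalHomBalanced (n : M) (X : N) :
    (internalHomBalanced k N m hN).evalMap m n X =
      freeCover hN (((internalHomBalanced k N m hN).functor.obj n).obj X) := by
  apply Monad.Algebra.Hom.ext
  exact (internalEndSMul_eq C m n X).symm

theorem freeCover_condition (X : (internalEndMonad C m N).Algebra) :
    ((internalHomBalanced k N m hN).functor.obj m).map (moduleAct C m X) ≫ freeCover hN X =
      (internalHomBalanced k N m hN).evalMap m m X.A ≫ freeCover hN X := by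
  rw [evalMap_internalHomBalanced]
  exact Monad.FreeCoequalizer.condition X

/-- A module is a coequalizer of free modules. -/
noncomputable def isColimitFreeCover (X : (internalEndMonad C m N).Algebra) :
    IsColimit (Cofork.ofπ (freeCover hN X) (freeCover_condition hN X)) :=
  Cofork.IsColimit.mk _
    (fun s => Cofork.IsColimit.desc (Monad.beckAlgebraCoequalizer X) s.π (by
      have := s.condition
      exact this.trans (congrArg (· ≫ s.π) (evalMap_internalHomBalanced hN m X.A))))
    (fun s => Cofork.IsColimit.π_desc' (Monad.beckAlgebraCoequalizer X) _ _)
    (fun s f hf => Cofork.IsColimit.hom_ext (Monad.beckAlgebraCoequalizer X)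
      (hf.trans (Cofork.IsColimit.π_desc' (Monad.beckAlgebraCoequalizer X) _ _).symm))

/-- The image of the presentation of a module under a cocontinuous functor. -/
noncomputable def isColimitMapFreeCover
    (L : CocontinuousFunctor k (internalEndMonad C m N).Algebra E)
    (X : (internalEndMonad C m N).Algebra) :
    IsColimit (Cofork.ofπ (f := L.obj.map (((internalHomBalanced k N m hN).functor.obj m).map
      (moduleAct C m X)))
      (g := L.obj.map ((internalHomBalanced k N m hN).evalMap m m X.A))
      (L.obj.map (freeCover hN X))
      (by rw [← Functor.map_comp, freeCover_condition, Functor.map_comp])) :=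
  have := L.property.preservesColimits
  isColimitCoforkMapOfIsColimit L.obj (freeCover_condition hN X) (isColimitFreeCover hN X)

theorem evalMap_postcomp (L : CocontinuousFunctor k (internalEndMonad C m N).Algebra E)
    (n : M) (X : N) :
    (((internalHomBalanced k N m hN).postcomp E).obj L).evalMap m n X =
      L.obj.map ((internalHomBalanced k N m hN).evalMap m n X) := by
  rw [evalMap, evalMap, Functor.map_comp]
  rfl

variable {hN} in
/-- The components of a morphism between functors composed with the universal balanced functor. -/
def natTransApp {L L' : CocontinuousFunctor k (internalEndMonad C m N).Algebra E}
    (σ : ((internalHomBalanced k N m hN).postcomp E).obj L ⟶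
      ((internalHomBalanced k N m hN).postcomp E).obj L') (n : M) (X : N) :
    L.obj.obj (((internalHomBalanced k N m hN).functor.obj n).obj X) ⟶
      L'.obj.obj (((internalHomBalanced k N m hN).functor.obj n).obj X) :=
  ((Hom.natTrans σ).app n).app X

theorem natTransApp_naturality {L L' : CocontinuousFunctor k (internalEndMonad C m N).Algebra E}
    (σ : ((internalHomBalanced k N m hN).postcomp E).obj L ⟶
      ((internalHomBalanced k N m hN).postcomp E).obj L') (n : M) {X Y : N} (f : X ⟶ Y) :
    L.obj.map (((internalHomBalanced k N m hN).functor.obj n).map f) ≫ natTransApp σ n Y =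
      natTransApp σ n X ≫ L'.obj.map (((internalHomBalanced k N m hN).functor.obj n).map f) :=
  ((Hom.natTrans σ).app n).naturality f

theorem evalMap_natTransApp {L L' : CocontinuousFunctor k (internalEndMonad C m N).Algebra E}
    (σ : ((internalHomBalanced k N m hN).postcomp E).obj L ⟶
      ((internalHomBalanced k N m hN).postcomp E).obj L') (n : M) (X : N) :
    L.obj.map ((internalHomBalanced k N m hN).evalMap m n X) ≫ natTransApp σ n X =
      natTransApp σ m ((internalHom C m).obj n ⊙ₗ X) ≫
        L'.obj.map ((internalHomBalanced k N m hN).evalMap m n X) := by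
  have h := Hom.evalMap m σ n X
  rwa [evalMap_postcomp, evalMap_postcomp] at h

variable {hN} in
/-- The components of the natural transformation induced by a morphism of balanced functors. -/
noncomputable def descApp
    {L L' : CocontinuousFunctor k (internalEndMonad C m N).Algebra E}
    (σ : ((internalHomBalanced k N m hN).postcomp E).obj L ⟶
      ((internalHomBalanced k N m hN).postcomp E).obj L')
    (X : (internalEndMonad C m N).Algebra) : L.obj.obj X ⟶ L'.obj.obj X :=
  Cofork.IsColimit.desc (isColimitMapFreeCover hN L X)
    (natTransApp σ m X.A ≫ L'.obj.map (freeCover hN X)) (by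
      rw [reassoc_of% natTransApp_naturality, reassoc_of% evalMap_natTransApp, ← Functor.map_comp,
        freeCover_condition, Functor.map_comp])

variable {hN} in
theorem freeCover_descApp {L L' : CocontinuousFunctor k (internalEndMonad C m N).Algebra E}
    (σ : ((internalHomBalanced k N m hN).postcomp E).obj L ⟶
      ((internalHomBalanced k N m hN).postcomp E).obj L')
    (X : (internalEndMonad C m N).Algebra) :
    L.obj.map (freeCover hN X) ≫ descApp σ X =
      natTransApp σ m X.A ≫ L'.obj.map (freeCover hN X) :=
  Cofork.IsColimit.π_desc' (isColimitMapFreeCover hN L X) _ _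

theorem epi_map_freeCover (L : CocontinuousFunctor k (internalEndMonad C m N).Algebra E)
    (X : (internalEndMonad C m N).Algebra) : Epi (L.obj.map (freeCover hN X)) :=
  ⟨fun _ _ h => Cofork.IsColimit.hom_ext (isColimitMapFreeCover hN L X) h⟩

theorem faithful_postcomp : ((internalHomBalanced k N m hN).postcomp E).Faithful where
  map_injective {L L'} σ τ h := by
    apply ObjectProperty.hom_ext
    ext X
    have := epi_map_freeCover hN L X
    rw [← cancel_epi (L.obj.map (freeCover hN X)), σ.hom.naturality, τ.hom.naturality]
    have h1 := congrArg (fun t => ((Hom.natTrans t).app m).app X.A) h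
    exact congrArg (· ≫ _) h1

theorem full_postcomp : ((internalHomBalanced k N m hN).postcomp E).Full where
  map_surjective {L L'} σ := by
    refine ⟨ObjectProperty.homMk { app := descApp σ, naturality := fun X Y f => ?_ },
      Hom.ext ?_⟩
    · have := epi_map_freeCover hN L X
      rw [← cancel_epi (L.obj.map (freeCover hN X)), ← Functor.map_comp_assoc,
        ← freeCover_naturality, Functor.map_comp, Category.assoc, freeCover_descApp,
        reassoc_of% freeCover_descApp, ← Functor.map_comp, ← freeCover_naturality, Functor.map_comp,
        reassoc_of% natTransApp_naturality]
    · ext n X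
      have := epi_map_freeCover hN L (((internalHomBalanced k N m hN).functor.obj n).obj X)
      change descApp σ (((internalHomBalanced k N m hN).functor.obj n).obj X) = natTransApp σ n X
      rw [← cancel_epi (L.obj.map (freeCover hN _)), freeCover_descApp,
        ← evalMap_internalHomBalanced]
      exact (evalMap_natTransApp hN σ n X).symm

section Extension

variable (m) in
/-- The functor `X ↦ G(m, X)` on modules. -/
noncomputable abbrev extensionTarget (G : BalancedFunctor k C M N E) :
    (internalEndMonad C m N).Algebra ⥤ E :=
  (internalEndMonad C m N).forget ⋙ G.functor.obj m

variable (m) in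
/-- The functor `X ↦ G(m, Hom(m, m) ⊙ X)` on modules. -/
noncomputable abbrev extensionSource (G : BalancedFunctor k C M N E) :
    (internalEndMonad C m N).Algebra ⥤ E :=
  (internalEndMonad C m N).forget ⋙ (internalEndMonad C m N).toFunctor ⋙ G.functor.obj m

variable (m) in
/-- The transformation `G(m, Hom(m, m) ⊙ X) ⟶ G(m, X)` given by the action on `X`. -/
noncomputable def extensionAct (G : BalancedFunctor k C M N E) :
    extensionSource m G ⟶ extensionTarget m G where
  app X := (G.functor.obj m).map (moduleAct C m X)
  naturality X Y f := by
    have h : (internalHom C m).obj m ⊴ₗ f.f ≫ moduleAct C m Y = moduleAct C m X ≫ f.f := f.h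
    have h2 := congrArg (G.functor.obj m).map h
    rw [Functor.map_comp, Functor.map_comp] at h2
    exact h2

variable (m) in
/-- The transformation `G(m, Hom(m, m) ⊙ X) ⟶ G(m, X)` given by the balancing and evaluation. -/
noncomputable def extensionEval (G : BalancedFunctor k C M N E) :
    extensionSource m G ⟶ extensionTarget m G where
  app X := G.evalMap m m X.A
  naturality _ _ f := G.evalMap_naturality_right m m f.f

variable [HasColimitsOfSize.{v, v} E]

variable (m) in
/-- The extension of a balanced functor to the category of modules. -/
noncomputable def extension (G : BalancedFunctor k C M N E) :
    (internalEndMonad C m N).Algebra ⥤ E :=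
  coequalizer (extensionAct m G) (extensionEval m G)

variable (m) in
/-- The projection `G(m, X) ⟶ L(X)` to the extension `L` of a balanced functor `G`. -/
noncomputable def extensionπ (G : BalancedFunctor k C M N E) :
    extensionTarget m G ⟶ extension m G :=
  coequalizer.π (extensionAct m G) (extensionEval m G)

theorem extension_condition (G : BalancedFunctor k C M N E)
    (X : (internalEndMonad C m N).Algebra) :
    (extensionAct m G).app X ≫ (extensionπ m G).app X =
      (extensionEval m G).app X ≫ (extensionπ m G).app X := by
  exact NatTrans.congr_app (coequalizer.condition (extensionAct m G) (extensionEval m G)) X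

variable (m) in
/-- The extension of a balanced functor is pointwise a coequalizer. -/
noncomputable def isColimitExtension (G : BalancedFunctor k C M N E)
    (X : (internalEndMonad C m N).Algebra) :
    IsColimit (Cofork.ofπ ((extensionπ m G).app X) (extension_condition G X)) :=
  isColimitCoforkMapOfIsColimit ((evaluation _ _).obj X) _
    (coequalizerIsCoequalizer (extensionAct m G) (extensionEval m G))

theorem isCocontinuous_extension [HasColimitsOfSize.{v, v} N]
    (hT : IsCocontinuous k (internalEndMonad C m N).toFunctor)
    (G : BalancedFunctor k C M N E) : IsCocontinuous k (extension m G) := by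
  have := hT.preservesColimits
  have h1 := isCocontinuous_forget (k := k) (internalEndMonad C m N)
  have h2 := G.isBicocontinuous.right m
  exact isCocontinuous_of_isColimit_cofork (h1.comp (hT.comp h2)) (h1.comp h2) (extensionπ m G)
    (extension_condition G) (isColimitExtension m G)

/-- The comparison between a balanced functor and its extension. -/
noncomputable def extensionApp (G : BalancedFunctor k C M N E) (n : M) (X : N) :
    (extension m G).obj (((internalHomTensorFunctor C m).obj n).obj X) ⟶
      (G.functor.obj n).obj X :=
  Cofork.IsColimit.desc (isColimitExtension m G _) (G.evalMap m n X)
    (G.evalMap_evalMap m n X).symm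

theorem extensionπ_extensionApp (G : BalancedFunctor k C M N E) (n : M) (X : N) :
    (extensionπ m G).app (((internalHomTensorFunctor C m).obj n).obj X) ≫ G.extensionApp n X =
      G.evalMap m n X :=
  Cofork.IsColimit.π_desc' (isColimitExtension m G _) _ _

instance epi_extensionπ_app (G : BalancedFunctor k C M N E)
    (X : (internalEndMonad C m N).Algebra) : Epi ((extensionπ m G).app X) :=
  ⟨fun _ _ h => Cofork.IsColimit.hom_ext (isColimitExtension m G X) h⟩

/-- If the evaluation `m ⊙ Hom(m, n) ⟶ n` has a section, then `G(n, X)` is a split coequalizer. -/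
noncomputable def isSplitCoequalizerEvalMap (G : BalancedFunctor k C M N E) (n : M) (X : N)
    (s : n ⟶ m ⊙ᵣ (internalHom C m).obj n) (hs : s ≫ internalEval C m n = 𝟙 n) :
    IsSplitCoequalizer (G.evalMap m m ((internalHom C m).obj n ⊙ₗ X))
      ((G.functor.obj m).map (internalEndSMul C m n X)) (G.evalMap m n X) where
  rightSection := (G.functor.map s).app X ≫ (G.balancing m ((internalHom C m).obj n) X).hom
  leftSection := (G.functor.obj m).map ((internalHom C m).map s ⊵ₗ X ≫
    inv (internalHomBalancing C m m ((internalHom C m).obj n) X))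
  condition := G.evalMap_evalMap m n X
  rightSection_π := by
    rw [evalMap, Category.assoc, Iso.hom_inv_id_assoc, ← NatTrans.comp_app, ← Functor.map_comp, hs]
    simp
  leftSection_bottom := by
    rw [← Functor.map_comp, Category.assoc, internalEndSMul_eq, ← internalHomBalancing.eq_def,
      IsIso.inv_hom_id_assoc, ← MonoidalLeftAction.comp_actionHomLeft, ← Functor.map_comp, hs]
    simp
  leftSection_top := by
    rw [← evalMap_balancing, ← internalHomBalancing.eq_def, ← Functor.map_comp_assoc,
      Category.assoc, IsIso.inv_hom_id, Category.comp_id, reassoc_of% evalMap_naturality_left]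

theorem isIso_extensionApp [∀ n : M, IsSplitEpi (internalEval C m n)]
    (G : BalancedFunctor k C M N E) (n : M) (X : N) : IsIso (extensionApp (m := m) G n X) := by
  let t := G.isSplitCoequalizerEvalMap n X (section_ (internalEval C m n)) (IsSplitEpi.id _)
  let Y := ((internalHomTensorFunctor C m).obj n).obj X
  let π : (G.functor.obj m).obj ((internalHom C m).obj n ⊙ₗ X) ⟶
    (extension m G).obj (((internalHomTensorFunctor C m).obj n).obj X) := (extensionπ m G).app Y
  have hw : (G.functor.obj m).map (internalEndSMul C m n X) ≫ π =
      G.evalMap m m ((internalHom C m).obj n ⊙ₗ X) ≫ π := extension_condition G Y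
  have hπ : π ≫ G.extensionApp n X = G.evalMap m n X := extensionπ_extensionApp G n X
  have : Epi π := epi_extensionπ_app G Y
  refine ⟨t.rightSection ≫ π, ?_, ?_⟩
  · rw [← cancel_epi π, reassoc_of% hπ, ← t.leftSection_top_assoc, ← hw,
      t.leftSection_bottom_assoc, Category.comp_id]
  · rw [Category.assoc, hπ, t.rightSection_π]

theorem extensionApp_naturality_right (G : BalancedFunctor k C M N E) (n : M) {X Y : N}
    (f : X ⟶ Y) :
    (extension m G).map (((internalHomTensorFunctor C m).obj n).map f) ≫ G.extensionApp n Y =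
      G.extensionApp n X ≫ (G.functor.obj n).map f := by
  rw [← cancel_epi ((extensionπ m G).app _), ← (extensionπ m G).naturality_assoc,
    extensionπ_extensionApp, reassoc_of% extensionπ_extensionApp]
  exact G.evalMap_naturality_right m n f

theorem extensionApp_naturality_left (G : BalancedFunctor k C M N E) {n n' : M} (f : n ⟶ n')
    (X : N) :
    (extension m G).map (((internalHomTensorFunctor C m).map f).app X) ≫ G.extensionApp n' X =
      G.extensionApp n X ≫ (G.functor.map f).app X := by
  rw [← cancel_epi ((extensionπ m G).app _), ← (extensionπ m G).naturality_assoc,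
    extensionπ_extensionApp, reassoc_of% extensionπ_extensionApp]
  exact G.evalMap_naturality_left m f X

theorem extensionApp_balancing (G : BalancedFunctor k C M N E) (n : M) (c : C) (X : N) :
    G.extensionApp (n ⊙ᵣ c) X ≫ (G.balancing n c X).hom =
      (extension m G).map (internalHomBalancingIso C m n c X).inv ≫
        G.extensionApp n (c ⊙ₗ X) := by
  rw [← cancel_epi ((extension m G).map (internalHomBalancingIso C m n c X).hom),
    ← Functor.map_comp_assoc, Iso.hom_inv_id, CategoryTheory.Functor.map_id, Category.id_comp,
    ← cancel_epi ((extensionπ m G).app _), ← (extensionπ m G).naturality_assoc,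
    reassoc_of% extensionπ_extensionApp, extensionπ_extensionApp]
  exact G.evalMap_balancing m n c X

theorem essSurj_postcomp [HasColimitsOfSize.{v, v} N]
    (hT : IsCocontinuous k (internalEndMonad C m N).toFunctor)
    [∀ n : M, IsSplitEpi (internalEval C m n)] :
    ((internalHomBalanced k N m hN).postcomp E).EssSurj where
  mem_essImage G := ⟨⟨extension m G, isCocontinuous_extension hT G⟩, ⟨isoOfComponents
    { natTrans :=
        { app := fun n =>
            { app := fun X => G.extensionApp n X
              naturality := fun _ _ f => G.extensionApp_naturality_right n f }
          naturality := fun _ _ f => NatTrans.ext (funext fun X =>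
            G.extensionApp_naturality_left f X) }
      comm := fun n c X => G.extensionApp_balancing n c X }
    fun n X => G.isIso_extensionApp n X⟩⟩

theorem isEquivalence_postcomp [HasColimitsOfSize.{v, v} N]
    (hT : IsCocontinuous k (internalEndMonad C m N).toFunctor)
    [∀ n : M, IsSplitEpi (internalEval C m n)] :
    ((internalHomBalanced k N m hN).postcomp E).IsEquivalence where
  faithful := faithful_postcomp hN
  full := full_postcomp hN
  essSurj := essSurj_postcomp hN hT

end Extension

end BalancedFunctor

section Generation

variable {P : Type (v + 1)} [Category.{v} P]

/-- The closure of a property of objects under all small colimits. -/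
abbrev smallColimitsClosure (R : ObjectProperty P) : ObjectProperty P :=
  R.colimitsClosure (fun J : Cat.{v, v} => (J : Type v))

instance (R : ObjectProperty P) (J : Type v) [SmallCategory J] :
    (smallColimitsClosure R).IsClosedUnderColimitsOfShape J :=
  inferInstanceAs ((R.colimitsClosure
    (fun J : Cat.{v, v} => (J : Type v))).IsClosedUnderColimitsOfShape (Cat.of J))

theorem smallColimitsClosure_hom_ext {R : ObjectProperty P} {X Y : P} {f g : X ⟶ Y}
    (h : ∀ Z, R Z → ∀ u : Z ⟶ X, u ≫ f = u ≫ g) {Z : P} (hZ : smallColimitsClosure R Z)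
    (u : Z ⟶ X) : u ≫ f = u ≫ g := by
  induction hZ with
  | of_mem Z hZ => exact h Z hZ u
  | of_isoClosure e _ ih =>
    rw [← cancel_epi e.hom, ← Category.assoc, ih, Category.assoc]
  | of_colimitPresentation pres _ ih =>
    exact pres.isColimit.hom_ext fun j => by
      rw [← Category.assoc, ih, Category.assoc]

theorem isColocal_of_smallColimitsClosure {R : ObjectProperty P} {X Y : P} {f : X ⟶ Y}
    (h : R.isColocal f) : (smallColimitsClosure R).isColocal f := by
  have : smallColimitsClosure R ≤ (MorphismProperty.single f).isColocal :=
    ObjectProperty.colimitsClosure_le fun Z hZ =>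
      (MorphismProperty.isColocal_single_iff_bijective f Z).2 (h Z hZ)
  exact fun Z hZ => (MorphismProperty.isColocal_single_iff_bijective f Z).1 (this Z hZ)

variable [HasColimitsOfSize.{v, v} P]

instance (R : ObjectProperty P) :
    HasColimitsOfSize.{v, v} (smallColimitsClosure R).FullSubcategory where
  has_colimits_of_shape _ _ := inferInstance

instance (R : ObjectProperty P) :
    PreservesColimitsOfSize.{v, v} (smallColimitsClosure R).ι where

theorem isLocallyFinitelyPresentable_smallColimitsClosure {ι : Type v} (X : ι → P)
    (hX : ∀ i, IsFinitelyPresentable.{v} (X i)) : IsLocallyFinitelyPresentable.{v}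
      (smallColimitsClosure (ObjectProperty.ofObj X)).FullSubcategory := by
  have := Cardinal.fact_isRegular_aleph0.{v}
  let R := smallColimitsClosure (ObjectProperty.ofObj X)
  have hR (i : ι) : R (X i) := .of_mem _ ⟨i⟩
  rw [IsLocallyFinitelyPresentable, IsCardinalLocallyPresentable.iff_exists_isStrongGenerator]
  refine ⟨ObjectProperty.ofObj (fun i => (⟨X i, hR i⟩ : R.FullSubcategory)), inferInstance,
    ?_, ?_⟩
  · rw [ObjectProperty.isStrongGenerator_iff]
    have sep : (ObjectProperty.ofObj
        (fun i => (⟨X i, hR i⟩ : R.FullSubcategory))).IsSeparating := by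
      refine fun Y Z f g h => ObjectProperty.hom_ext _ ?_
      have := smallColimitsClosure_hom_ext (R := ObjectProperty.ofObj X) (f := f.hom)
        (g := g.hom) (by
          rintro _ ⟨i⟩ u
          exact congrArg (fun t => t.hom) (h _ ⟨i⟩ (ObjectProperty.homMk u))) Y.property (𝟙 _)
      simpa using this
    refine ⟨sep, fun Y Z f _ h => ?_⟩
    rw [← ObjectProperty.isIso_hom_iff]
    refine (ObjectProperty.isColocal_iff_isIso R f.hom Y.property Z.property).1
      (isColocal_of_smallColimitsClosure ?_)
    rintro _ ⟨i⟩
    refine ⟨fun a b hab => ?_, fun a => ?_⟩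
    · have : (ObjectProperty.homMk a : (⟨X i, hR i⟩ : R.FullSubcategory) ⟶ Y) =
          ObjectProperty.homMk b := by
        rw [← cancel_mono f]
        exact ObjectProperty.hom_ext _ hab
      exact congrArg (fun t => t.hom) this
    · obtain ⟨b, hb⟩ := h _ ⟨i⟩ (ObjectProperty.homMk a)
      exact ⟨b.hom, congrArg (fun t => t.hom) hb⟩
  · rintro _ ⟨i⟩
    have : IsCardinalPresentable (X i) Cardinal.aleph0.{v} := hX i
    let e : R.ι ⋙ coyoneda.obj (Opposite.op (X i)) ≅
        coyoneda.obj (Opposite.op (⟨X i, hR i⟩ : R.FullSubcategory)) :=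
      NatIso.ofComponents (fun Y =>
        { hom := ↾fun a => ObjectProperty.homMk a
          inv := ↾fun a => a.hom }) (fun _ => rfl)
    have : (R.ι ⋙ coyoneda.obj (Opposite.op (X i))).IsCardinalAccessible Cardinal.aleph0.{v} :=
      inferInstance
    exact Functor.isCardinalAccessible_of_natIso e Cardinal.aleph0.{v}

end Generation

section Kelly

variable {k : Type v} [Field k]
  {C D P : Type (v + 1)}
  [Category.{v} C] [Preadditive C] [Linear k C]
  [Category.{v} D] [Preadditive D] [Linear k D]
  [Category.{v} P] [Preadditive P] [Linear k P]
  {B : C ⥤ D ⥤ P}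

theorem isCocontinuous_lift {R : ObjectProperty P} [PreservesColimitsOfSize.{v, v} R.ι]
    {F : C ⥤ P} (hF : IsCocontinuous k F) (h : ∀ c, R (F.obj c)) :
    IsCocontinuous k (R.lift F h) where
  additive := ⟨ObjectProperty.hom_ext _ hF.additive.map_add⟩
  linear := ⟨fun f r => ObjectProperty.hom_ext _ (hF.linear.map_smul f r)⟩
  preservesColimits := by
    have : PreservesColimitsOfSize.{v, v} (R.lift F h ⋙ R.ι) := hF.preservesColimits
    exact preservesColimits_of_reflects_of_preserves _ R.ι

theorem smallColimitsClosure_bifunctor (hB : IsBicocontinuous k B) {PC : ObjectProperty C}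
    {PD : ObjectProperty D} {R : ObjectProperty P}
    (h : ∀ c d, PC c → PD d → smallColimitsClosure R ((B.obj c).obj d)) {c : C} {d : D}
    (hc : smallColimitsClosure PC c) (hd : smallColimitsClosure PD d) :
    smallColimitsClosure R ((B.obj c).obj d) := by
  induction hc with
  | of_mem c hc =>
    induction hd with
    | of_mem d hd => exact h c d hc hd
    | of_isoClosure e _ ih => exact .of_isoClosure ((B.obj c).mapIso e) ih
    | of_colimitPresentation p _ ih =>
      have := (hB.right c).preservesColimits
      exact .of_colimitPresentation (p.map (B.obj c)) ih
  | of_isoClosure e _ ih => exact .of_isoClosure ((B.mapIso e).app d) ih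
  | of_colimitPresentation p _ ih =>
    have := (hB.left d).preservesColimits
    exact .of_colimitPresentation (p.map (B.flip.obj d)) ih

attribute [local instance] Cardinal.fact_isRegular_aleph0 in
theorem exists_small_generator_finitelyPresentable (C : Type (v + 1)) [Category.{v} C]
    [IsLocallyFinitelyPresentable.{v} C] : ∃ (ι : Type v) (X : ι → C),
      (∀ i, IsFinitelyPresentable.{v} (X i)) ∧
      ∀ c, smallColimitsClosure (ObjectProperty.ofObj X) c := by
  obtain ⟨P, _, hP⟩ :=
    HasCardinalFilteredGenerator.exists_small_generator C Cardinal.aleph0.{v}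
  refine ⟨Shrink.{v} (Subtype P), fun i => ((equivShrink _).symm i).1,
    fun i => hP.le_isCardinalPresentable _ ((equivShrink _).symm i).2, fun c => ?_⟩
  obtain ⟨J, _, _, ⟨p⟩⟩ := hP.exists_colimitsOfShape c
  refine .of_colimitPresentation (a := Cat.of J) p.toColimitPresentation fun j => .of_mem _ ?_
  have := ObjectProperty.ofObj_apply (fun i => ((equivShrink.{v} (Subtype P)).symm i).1)
    (equivShrink.{v} (Subtype P) ⟨_, p.prop_diag_obj j⟩)
  simpa using this

/-- The Deligne-Kelly tensor product is generated under colimits by the objects `B (c, d)` with `c`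
and `d` compact. -/
theorem IsKellyTensorProduct.smallColimitsClosure_compact [IsLocallyFinitelyPresentable.{v} C]
    [IsLocallyFinitelyPresentable.{v} D] (hB : IsKellyTensorProduct k B)
    {Q : ObjectProperty P}
    (h : ∀ c d, IsFinitelyPresentable.{v} c → IsFinitelyPresentable.{v} d →
      Q ((B.obj c).obj d)) (X : P) : smallColimitsClosure Q X := by
  have := hB.locallyFinitelyPresentable
  obtain ⟨ι, c, hc, hc'⟩ := exists_small_generator_finitelyPresentable C
  obtain ⟨κ, d, hd, hd'⟩ := exists_small_generator_finitelyPresentable D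
  let Y : ι × κ → P := fun i => (B.obj (c i.1)).obj (d i.2)
  let R := smallColimitsClosure (ObjectProperty.ofObj Y)
  have hR (x : C) (y : D) : R ((B.obj x).obj y) :=
    smallColimitsClosure_bifunctor hB.isBicocontinuous (by
      rintro _ _ ⟨i⟩ ⟨j⟩
      exact .of_mem _ ⟨(i, j)⟩) (hc' x) (hd' y)
  have := isLocallyFinitelyPresentable_smallColimitsClosure Y
    (fun i => hB.isQuasiProper _ _ (hc i.1) (hd i.2))
  let B' : C ⥤ D ⥤ R.FullSubcategory :=
    { obj := fun x => R.lift (B.obj x) (hR x)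
      map := fun f => { app := fun y => ObjectProperty.homMk ((B.map f).app y) } }
  have hB' : IsBicocontinuous k B' :=
    ⟨fun y => isCocontinuous_lift (hB.isBicocontinuous.left y) (fun x => hR x y),
      fun x => isCocontinuous_lift (hB.isBicocontinuous.right x) (hR x)⟩
  have := hB.universal R.FullSubcategory
  have := hB.universal P
  let F := BicocontinuousFunctor.postcomp
    (⟨B, hB.isBicocontinuous⟩ : BicocontinuousFunctor k C D P)
  let L := (F R.FullSubcategory).objPreimage ⟨B', hB'⟩
  let e : B ⋙ (Functor.whiskeringRight D P _).obj L.obj ≅ B' :=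
    (ObjectProperty.ι _).mapIso ((F R.FullSubcategory).objObjPreimageIso ⟨B', hB'⟩)
  have hι : IsCocontinuous k R.ι := ⟨inferInstance, ⟨fun _ _ => rfl⟩, inferInstance⟩
  let L' : CocontinuousFunctor k P P := ⟨L.obj ⋙ R.ι, L.property.comp hι⟩
  let I : CocontinuousFunctor k P P := ⟨𝟭 P, ⟨inferInstance, inferInstance, inferInstance⟩⟩
  let e' : (F P).obj L' ≅ (F P).obj I := ObjectProperty.isoMk _
    (Functor.isoWhiskerRight e ((Functor.whiskeringRight D _ P).obj R.ι))
  let e'' : L.obj ⋙ R.ι ≅ 𝟭 P := (ObjectProperty.ι _).mapIso ((F P).preimageIso e')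
  have : R ≤ smallColimitsClosure Q := ObjectProperty.colimitsClosure_monotone _ (by
    rintro _ ⟨i⟩
    exact h _ _ (hc i.1) (hd i.2))
  exact .of_isoClosure (e''.app X) (this _ (L.obj.obj X).property)

end Kelly

section Presentable

variable {C D : Type (v + 1)} [Category.{v} C] [Category.{v} D]

theorem IsCocontinuous.of_iso {k : Type v} [Field k] [Preadditive C] [Linear k C]
    [Preadditive D] [Linear k D] {F G : C ⥤ D} (hF : IsCocontinuous k F) (e : F ≅ G) :
    IsCocontinuous k G where
  additive := have := hF.additive; Functor.additive_of_iso e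
  linear := by
    have := hF.linear
    refine ⟨fun {X Y} f r => ?_⟩
    rw [← cancel_epi (e.hom.app X), ← e.hom.naturality, Linear.comp_smul, ← e.hom.naturality,
      F.map_smul, Linear.smul_comp]
  preservesColimits := by
    have := hF.preservesColimits
    exact preservesColimits_of_natIso e

theorem isIso_app_of_colimitPresentation {F G : C ⥤ D} (τ : F ⟶ G) {J : Type v}
    [SmallCategory J] {X : C} (p : ColimitPresentation J X) [PreservesColimit p.diag F]
    [PreservesColimit p.diag G] (h : ∀ j, IsIso (τ.app (p.diag.obj j))) : IsIso (τ.app X) := by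
  let α : p.diag ⋙ F ≅ p.diag ⋙ G := NatIso.ofComponents (fun j => asIso (τ.app (p.diag.obj j)))
  have : τ.app X = (IsColimit.coconePointsIsoOfNatIso (isColimitOfPreserves F p.isColimit)
      (isColimitOfPreserves G p.isColimit) α).hom := by
    refine (isColimitOfPreserves F p.isColimit).hom_ext fun j => ?_
    rw [IsColimit.comp_coconePointsIsoOfNatIso_hom]
    exact τ.naturality _
  rw [this]
  infer_instance

theorem isIso_app_of_smallColimitsClosure {F G : C ⥤ D} (τ : F ⟶ G)
    [PreservesColimitsOfSize.{v, v} F] [PreservesColimitsOfSize.{v, v} G] {Q : ObjectProperty C}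
    (h : ∀ X, Q X → IsIso (τ.app X)) {X : C} (hX : smallColimitsClosure Q X) :
    IsIso (τ.app X) := by
  induction hX with
  | of_mem X hX => exact h X hX
  | of_isoClosure e _ ih => exact (NatTrans.isIso_app_iff_of_iso τ e).1 ih
  | of_colimitPresentation p _ ih => exact isIso_app_of_colimitPresentation τ p ih

attribute [local instance] Cardinal.fact_isRegular_aleph0 in
theorem isIso_app_of_isFinitelyPresentable [IsLocallyFinitelyPresentable.{v} C] {F G : C ⥤ D}
    (τ : F ⟶ G) [PreservesFilteredColimitsOfSize.{v, v} F]
    [PreservesFilteredColimitsOfSize.{v, v} G]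
    (h : ∀ X, IsFinitelyPresentable.{v} X → IsIso (τ.app X)) (X : C) : IsIso (τ.app X) := by
  obtain ⟨P, _, hP⟩ :=
    HasCardinalFilteredGenerator.exists_small_generator C Cardinal.aleph0.{v}
  obtain ⟨J, _, _, ⟨p⟩⟩ := hP.exists_colimitsOfShape X
  have : IsFiltered J := isFiltered_of_isCardinalFiltered J Cardinal.aleph0.{v}
  exact isIso_app_of_colimitPresentation τ p.toColimitPresentation
    fun j => h _ (hP.le_isCardinalPresentable _ (p.prop_diag_obj j))

/-- A right adjoint preserves filtered colimits if the left adjoint sends a family of compact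
generators to compact objects. -/
theorem preservesFilteredColimits_rightAdjoint [HasColimitsOfSize.{v, v} D]
    [HasColimitsOfSize.{v, v} C]
    {F : C ⥤ D} {G : D ⥤ C} (adj : F ⊣ G)
    {Q : ObjectProperty C} (hQ : ∀ X, smallColimitsClosure Q X)
    (h : ∀ X, Q X → IsFinitelyPresentable.{v} X)
    (h' : ∀ X, Q X → IsFinitelyPresentable.{v} (F.obj X)) :
    PreservesFilteredColimitsOfSize.{v, v} G where
  preserves_filtered_colimits J _ _ := ⟨fun {K} => by
    have : IsIso (colimit.post K G) := by
      refine (ObjectProperty.isColocal_iff_isIso (smallColimitsClosure Q) _ (hQ _) (hQ _)).1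
        (isColocal_of_smallColimitsClosure fun X hX => ⟨fun a b hab => ?_, fun u => ?_⟩)
      · have := h X hX
        have := h' X hX
        obtain ⟨i, a, rfl⟩ :=
          IsFinitelyPresentable.exists_hom_of_isColimit (colimit.isColimit (K ⋙ G)) a
        obtain ⟨j, b, rfl⟩ :=
          IsFinitelyPresentable.exists_hom_of_isColimit (colimit.isColimit (K ⋙ G)) b
        have hab' : (adj.homEquiv _ _).symm a ≫ colimit.ι K i =
            (adj.homEquiv _ _).symm b ≫ colimit.ι K j := by
          apply (adj.homEquiv _ _).injective
          rw [adj.homEquiv_naturality_right, adj.homEquiv_naturality_right,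
            Equiv.apply_symm_apply, Equiv.apply_symm_apply]
          simpa using hab
        obtain ⟨l, p, q, hl⟩ := IsFinitelyPresentable.exists_eq_of_isColimit
          (colimit.isColimit K) _ _ hab'
        have hl' : a ≫ (K ⋙ G).map p = b ≫ (K ⋙ G).map q := by
          have := congrArg (adj.homEquiv _ _) hl
          rwa [adj.homEquiv_naturality_right, adj.homEquiv_naturality_right,
            Equiv.apply_symm_apply, Equiv.apply_symm_apply] at this
        change a ≫ colimit.ι (K ⋙ G) i = b ≫ colimit.ι (K ⋙ G) j
        rw [← colimit.w (K ⋙ G) p, ← colimit.w (K ⋙ G) q, ← Category.assoc, hl', Category.assoc]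
      · have := h' X hX
        obtain ⟨i, a, ha⟩ := IsFinitelyPresentable.exists_hom_of_isColimit (colimit.isColimit K)
          ((adj.homEquiv _ _).symm u)
        refine ⟨adj.homEquiv _ _ a ≫ colimit.ι (K ⋙ G) i, ?_⟩
        dsimp only
        rw [Category.assoc, colimit.ι_post, ← adj.homEquiv_naturality_right]
        exact (congrArg _ ha).trans (Equiv.apply_symm_apply _ _)
    exact preservesColimit_of_isIso_post G K⟩

end Presentable

section InternalHom

open MonoidalRightAction

variable {C : Type (v + 1)} [Category.{v} C] [MonoidalCategory C]
  {M : Type (v + 1)} [Category.{v} M] [MonoidalRightAction C M]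
  {m : M} [(actionLeft C m).IsLeftAdjoint]

/-- The components of an isomorphism that exhibits `G` as a section of `m ⊙ -`. -/
abbrev sectionIso {G : M ⥤ C} (e : G ⋙ actionLeft C m ≅ 𝟭 M) (n : M) : m ⊙ᵣ G.obj n ≅ n :=
  e.app n

/-- For a section `G` of `m ⊙ -`, the comparison `Hom(m, m) ⊗ G n ⟶ Hom(m, n)`. -/
noncomputable def internalHomOfSection {G : M ⥤ C} (e : G ⋙ actionLeft C m ≅ 𝟭 M) :
    G ⋙ tensorLeft ((internalHom C m).obj m) ⟶ internalHom C m where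
  app n := internalHomTensor m m (G.obj n) ≫ (internalHom C m).map (sectionIso e n).hom
  naturality n n' f := by
    have h := internalHomTensor_naturality_right m m (G.map f)
    have h' : m ⊴ᵣ G.map f ≫ (sectionIso e n').hom = (sectionIso e n).hom ≫ f := e.hom.naturality f
    change (internalHom C m).obj m ◁ G.map f ≫ _ ≫ _ = _
    rw [reassoc_of% h, ← Functor.map_comp, h', Functor.map_comp, Category.assoc]

theorem isSplitEpi_internalEval {G : M ⥤ C} (e : G ⋙ actionLeft C m ≅ 𝟭 M) (n : M) :
    IsSplitEpi (internalEval C m n) :=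
  ⟨⟨(sectionIso e n).inv ≫ m ⊴ᵣ internalCurry (sectionIso e n).hom, by
    rw [Category.assoc, internalCurry_eval]
    exact (sectionIso e n).inv_hom_id⟩⟩

variable {k : Type v} [Field k] [Preadditive C] [Linear k C] [Preadditive M] [Linear k M]

theorem isCocontinuous_tensorLeft [MonoidalPreadditive C] [MonoidalLinear k C]
    [IsMonoidalCocontinuous C] (c : C) : IsCocontinuous k (tensorLeft c) where
  additive := inferInstance
  linear := inferInstance
  preservesColimits := IsMonoidalCocontinuous.preservesColimits_tensorLeft c

theorem isCocontinuous_tensorRight [MonoidalPreadditive C] [MonoidalLinear k C]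
    [IsMonoidalCocontinuous C] (c : C) : IsCocontinuous k (tensorRight c) where
  additive := inferInstance
  linear := inferInstance
  preservesColimits := IsMonoidalCocontinuous.preservesColimits_tensorRight c

/-- The internal hom `Hom(m, -)` is cocontinuous if it preserves filtered colimits and `m ⊙ -` has a
cocontinuous section which sends compact objects to dualizable ones. -/
theorem isCocontinuous_internalHom [MonoidalPreadditive C] [MonoidalLinear k C]
    [IsMonoidalCocontinuous C] [IsLocallyFinitelyPresentable.{v} M]
    [PreservesFilteredColimitsOfSize.{v, v} (internalHom C m)]
    {G : M ⥤ C} (hG : IsCocontinuous k G) (e : G ⋙ actionLeft C m ≅ 𝟭 M)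
    (h : ∀ n, IsFinitelyPresentable.{v} n → IsIso (internalHomTensor m m (G.obj n))) :
    IsCocontinuous k (internalHom C m) := by
  have hF : IsCocontinuous k (G ⋙ tensorLeft ((internalHom C m).obj m)) :=
    hG.comp (isCocontinuous_tensorLeft _)
  have := hF.preservesColimits
  have : PreservesFilteredColimitsOfSize.{v, v} (G ⋙ tensorLeft ((internalHom C m).obj m)) :=
    ⟨fun _ _ _ => inferInstance⟩
  have (n : M) : IsIso ((internalHomOfSection e).app n) :=
    isIso_app_of_isFinitelyPresentable _ (fun n hn => by
      have := h n hn
      change IsIso (internalHomTensor m m (G.obj n) ≫ (internalHom C m).map (sectionIso e n).hom)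
      infer_instance) n
  have : IsIso (internalHomOfSection e) := NatIso.isIso_of_isIso_app _
  exact hF.of_iso (asIso (internalHomOfSection e))

theorem isIso_internalHomTensor_of_smallColimitsClosure [IsMonoidalCocontinuous C]
    [PreservesColimitsOfSize.{v, v} (internalHom C m)] (n : M)
    [PreservesColimitsOfSize.{v, v} (actionLeft C n)] {Q : ObjectProperty C}
    (h : ∀ c, Q c → IsIso (internalHomTensor m n c)) (c : C) (hc : smallColimitsClosure Q c) :
    IsIso (internalHomTensor m n c) := by
  let τ : tensorLeft ((internalHom C m).obj n) ⟶ actionLeft C n ⋙ internalHom C m :=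
    { app := internalHomTensor m n
      naturality := fun _ _ f => internalHomTensor_naturality_right m n f }
  have := IsMonoidalCocontinuous.preservesColimits_tensorLeft ((internalHom C m).obj n)
  exact isIso_app_of_smallColimitsClosure τ h hc

end InternalHom

section Universal

open scoped MonoidalRightAction MonoidalLeftAction

variable {k : Type v} [Field k]
  {C : Type (v + 1)} [Category.{v} C] [Preadditive C] [Linear k C] [MonoidalCategory C]
  {M : Type (v + 1)} [Category.{v} M] [Preadditive M] [Linear k M] [MonoidalRightAction C M]
  {N : Type (v + 1)} [Category.{v} N] [Preadditive N] [Linear k N] [MonoidalLeftAction C N]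
  {m : M} [(MonoidalRightAction.actionLeft C m).IsLeftAdjoint]

theorem isCocontinuous_internalEndMonad
    (hN : IsBicocontinuous k (MonoidalLeftAction.curriedAction C N)) :
    IsCocontinuous k (internalEndMonad C m N).toFunctor :=
  hN.right _

theorem isBicocontinuous_internalHomTensorFunctor
    (hN : IsBicocontinuous k (MonoidalLeftAction.curriedAction C N))
    (hm : IsCocontinuous k (internalHom C m))
    [(internalEndMonad C m N).toFunctor.Additive]
    [(internalEndMonad C m N).toFunctor.Linear k] :
    IsBicocontinuous k (internalHomTensorFunctor C m (N := N)) := by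
  have := (isCocontinuous_internalEndMonad (m := m) hN).preservesColimits
  exact ⟨fun X => isCocontinuous_of_comp_forget _ (hm.comp (hN.left X)),
    fun n => isCocontinuous_of_comp_forget _ (hN.right ((internalHom C m).obj n))⟩

theorem isQuasiProper_internalHomTensorFunctor [HasColimitsOfSize.{v, v} N]
    [PreservesColimitsOfSize.{v, v} (internalEndMonad C m N).toFunctor]
    [∀ n c, IsIso (internalHomTensor (C := C) m n c)]
    {G : M ⥤ C} (e : G ⋙ MonoidalRightAction.actionLeft C m ≅ 𝟭 M)
    (hG : ∀ (n : M) (X : N), IsFinitelyPresentable.{v} n → IsFinitelyPresentable.{v} X →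
      IsFinitelyPresentable.{v} (G.obj n ⊙ₗ X)) :
    IsQuasiProper (internalHomTensorFunctor C m (N := N)) := by
  have := Cardinal.fact_isRegular_aleph0.{v}
  intro n X hn hX
  have : IsCardinalPresentable (((internalHomTensorFunctor C m).obj m).obj (G.obj n ⊙ₗ X))
      Cardinal.aleph0.{v} :=
    isFinitelyPresentable_free_obj (internalEndMonad C m N) _ (hG n X hn hX)
  exact isCardinalPresentable_of_iso (internalHomBalancingIso C m m (G.obj n) X ≪≫
    ((internalHomTensorFunctor C m).mapIso (sectionIso e n)).app X) Cardinal.aleph0.{v}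

end Universal

section Duals

open Functor.LaxMonoidal Functor.OplaxMonoidal

variable {C D : Type*} [Category* C] [Category* D] [MonoidalCategory C] [MonoidalCategory D]

/-- Strong monoidal functors preserve dual pairs. -/
@[reducible]
def mapExactPairing (F : C ⥤ D) [F.Monoidal] (X Y : C) [ExactPairing X Y] :
    ExactPairing (F.obj X) (F.obj Y) where
  coevaluation' := ε F ≫ F.map (η_ X Y) ≫ δ F X Y
  evaluation' := μ F Y X ≫ F.map (ε_ X Y) ≫ η F
  coevaluation_evaluation' := by
    have h := congrArg F.map (ExactPairing.coevaluation_evaluation X Y)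
    simp only [Functor.map_comp, Functor.Monoidal.map_whiskerLeft,
      Functor.Monoidal.map_whiskerRight, Functor.Monoidal.map_associator_inv, Category.assoc,
      Functor.Monoidal.μ_δ_assoc, Functor.Monoidal.map_rightUnitor, cancel_epi,
      Functor.Monoidal.map_leftUnitor_inv] at h
    simp only [← Category.assoc, cancel_mono] at h
    simp only [Category.assoc] at h
    simp only [MonoidalCategory.whiskerLeft_comp, MonoidalCategory.comp_whiskerRight,
      Category.assoc, reassoc_of% h, Functor.Monoidal.whiskerRight_ε_η,
      Functor.Monoidal.whiskerLeft_ε_η_assoc, Category.comp_id]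
  evaluation_coevaluation' := by
    have h := congrArg F.map (ExactPairing.evaluation_coevaluation X Y)
    simp only [Functor.map_comp, Functor.Monoidal.map_whiskerLeft,
      Functor.Monoidal.map_whiskerRight, Functor.Monoidal.map_associator, Category.assoc,
      Functor.Monoidal.μ_δ_assoc, Functor.Monoidal.map_leftUnitor, cancel_epi,
      Functor.Monoidal.map_rightUnitor_inv] at h
    simp only [← Category.assoc, cancel_mono] at h
    simp only [Category.assoc] at h
    simp only [MonoidalCategory.whiskerLeft_comp, MonoidalCategory.comp_whiskerRight,
      Category.assoc, reassoc_of% h, Functor.Monoidal.whiskerLeft_ε_η,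
      Functor.Monoidal.whiskerRight_ε_η_assoc, Category.comp_id]

/-- Dual pairs in a product of monoidal categories. -/
@[reducible]
def prodExactPairing (X Y : C) (X' Y' : D) [ExactPairing X Y] [ExactPairing X' Y'] :
    ExactPairing (X, X') (Y, Y') where
  coevaluation' := (η_ X Y, η_ X' Y')
  evaluation' := (ε_ X Y, ε_ X' Y')
  coevaluation_evaluation' := by ext <;> simp
  evaluation_coevaluation' := by ext <;> simp

end Duals

section Regular

open scoped MonoidalRightAction MonoidalLeftAction

variable {k : Type v} [Field k]
  {A : Type (v + 1)} [Category.{v} A] [Preadditive A] [Linear k A] [MonoidalCategory A]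
  [MonoidalPreadditive A] [MonoidalLinear k A] [IsTensorCategory A]
  {S : Type (v + 1)} [Category.{v} S] [Preadditive S] [Linear k S] [MonoidalCategory S]
  [MonoidalPreadditive S] [MonoidalLinear k S] [IsMonoidalCocontinuous S]
  (box : A × A ⥤ S) (T : S ⥤ A) [T.Monoidal] (φ : box ⋙ T ≅ tensor A)

instance : IsLocallyFinitelyPresentable.{v} (RegularModule T) :=
  IsTensorCategory.locallyFinitelyPresentable (A := A)

instance : HasColimitsOfSize.{v, v} (RegularModule T) :=
  have := IsTensorCategory.locallyFinitelyPresentable (A := A)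
  have := Cardinal.fact_isRegular_aleph0.{v}
  inferInstanceAs (HasColimitsOfSize.{v, v} A)

variable {T} in
theorem isBicocontinuous_curriedAction (hT : IsCocontinuous k T) :
    IsBicocontinuous k (MonoidalLeftAction.curriedAction S (RegularModule T)) where
  left X := (hT.comp (isCocontinuous_tensorRight (C := A) X) :)
  right s := (isCocontinuous_tensorLeft (k := k) (C := A) (T.obj s) :)

variable {T} in
theorem isCocontinuous_actionLeft (hT : IsCocontinuous k T) (n : RegularModule T) :
    IsCocontinuous k (MonoidalRightAction.actionLeft S n) :=
  (hT.comp (isCocontinuous_tensorLeft (C := A) n) :)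

/-- The functor `a ↦ a ⊠ 1`. -/
abbrev boxUnit : RegularModule T ⥤ S := (Functor.curry.obj box).flip.obj (𝟙_ A)

variable {box T}

/-- The isomorphism `1 ⊗ T (a ⊠ 1) ≅ a`. -/
def boxUnitIso :
    boxUnit box T ⋙ MonoidalRightAction.actionLeft S (RegularModule.of T (𝟙_ A)) ≅
      𝟭 (RegularModule T) :=
  let e : (Functor.curry.obj box).flip.obj (𝟙_ A) ⋙ T ⋙ tensorLeft (𝟙_ A) ≅ 𝟭 A :=
    NatIso.ofComponents (fun a => λ_ (T.obj (box.obj (a, 𝟙_ A))) ≪≫ φ.app (a, 𝟙_ A) ≪≫ ρ_ a)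
      (fun {a b} f => by
        have h := φ.hom.naturality (X := (a, 𝟙_ A)) (Y := (b, 𝟙_ A)) (Prod.mkHom f (𝟙 _))
        have h' := rightUnitor_naturality f
        dsimp at h h' ⊢
        rw [tensorHom_id] at h
        simp only [Category.assoc]
        rw [← h', ← reassoc_of% h]
        exact leftUnitor_naturality_assoc _ _)
  e

include φ in
theorem isFinitelyPresentable_box_smul {a b c : A} (ha : IsFinitelyPresentable.{v} a)
    (hb : IsFinitelyPresentable.{v} b) (hc : IsFinitelyPresentable.{v} c) :
    IsFinitelyPresentable.{v} (T.obj (box.obj (a, b)) ⊗ c) := by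
  have := Cardinal.fact_isRegular_aleph0.{v}
  have : IsCardinalPresentable ((tensorRight c).obj (a ⊗ b)) Cardinal.aleph0.{v} :=
    IsTensorCategory.compact_tensor _ _ (IsTensorCategory.compact_tensor _ _ ha hb) hc
  let e : a ⊗ b ≅ T.obj (box.obj (a, b)) := (φ.app (a, b)).symm
  exact isCardinalPresentable_of_iso ((tensorRight c).mapIso e) Cardinal.aleph0.{v}

theorem isIso_internalHomTensor_box [box.Monoidal] {m : RegularModule T}
    [(MonoidalRightAction.actionLeft S m).IsLeftAdjoint] (n : RegularModule T) {a b : A}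
    (ha : IsFinitelyPresentable.{v} a) (hb : IsFinitelyPresentable.{v} b) :
    IsIso (internalHomTensor m n (box.obj (a, b))) := by
  obtain ⟨ha'⟩ := IsTensorCategory.hasLeftDual a ha
  obtain ⟨hb'⟩ := IsTensorCategory.hasLeftDual b hb
  have := prodExactPairing (ᘁa) a (ᘁb) b
  have := mapExactPairing box (ᘁa, ᘁb) (a, b)
  exact isIso_internalHomTensor _ n _ (box.obj (ᘁa, ᘁb))

/-- The objects `a ⊠ b` for compact objects `a` and `b`. -/
inductive compactBox (box : A × A ⥤ S) : ObjectProperty S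
  | mk (a b : A) (ha : IsFinitelyPresentable.{v} a) (hb : IsFinitelyPresentable.{v} b) :
    compactBox box (box.obj (a, b))

section

variable [box.Monoidal] (hbox : IsKellyTensorProduct k (Functor.curry.obj box))
  (hT : IsCocontinuous k T)
  [(MonoidalRightAction.actionLeft S (RegularModule.of T (𝟙_ A))).IsLeftAdjoint]

include hbox in
theorem smallColimitsClosure_compactBox (s : S) : smallColimitsClosure (compactBox box) s :=
  have := IsTensorCategory.locallyFinitelyPresentable (A := A)
  hbox.smallColimitsClosure_compact (fun a b ha hb => .mk a b ha hb) s

include hbox φ in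
theorem isCocontinuous_internalHom_unit :
    IsCocontinuous k (internalHom S (RegularModule.of T (𝟙_ A))) := by
  have := Cardinal.fact_isRegular_aleph0.{v}
  have := hbox.locallyFinitelyPresentable
  have : HasColimitsOfSize.{v, v} S := inferInstance
  have : PreservesFilteredColimitsOfSize.{v, v} (internalHom S (RegularModule.of T (𝟙_ A))) := by
    refine preservesFilteredColimits_rightAdjoint (Adjunction.ofIsLeftAdjoint _)
      (smallColimitsClosure_compactBox hbox) ?_ ?_
    · rintro _ ⟨a, b, ha, hb⟩
      exact hbox.isQuasiProper a b ha hb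
    · rintro _ ⟨a, b, ha, hb⟩
      have : IsCardinalPresentable (T.obj (box.obj (a, b)) ⊗ 𝟙_ A) Cardinal.aleph0.{v} :=
        isFinitelyPresentable_box_smul φ ha hb IsTensorCategory.compact_unit
      exact isCardinalPresentable_of_iso (C := A) (ρ_ _ ≪≫ (λ_ _).symm) Cardinal.aleph0.{v}
  exact isCocontinuous_internalHom (hbox.isBicocontinuous.left (𝟙_ A)) (boxUnitIso φ)
    fun n hn => (isIso_internalHomTensor_box (box := box) (m := RegularModule.of T (𝟙_ A)) _
      (a := n)
      (b := 𝟙_ A) hn IsTensorCategory.compact_unit :)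

include hbox hT φ in
theorem isIso_internalHomTensor_unit (n : RegularModule T) (s : S) :
    IsIso (internalHomTensor (RegularModule.of T (𝟙_ A)) n s) := by
  have := (isCocontinuous_internalHom_unit φ hbox).preservesColimits
  have := (isCocontinuous_actionLeft hT n).preservesColimits
  refine isIso_internalHomTensor_of_smallColimitsClosure n ?_ s
    (smallColimitsClosure_compactBox hbox s)
  rintro _ ⟨a, b, ha, hb⟩
  exact isIso_internalHomTensor_box n ha hb

theorem additive_internalEndMonad (hT : IsCocontinuous k T) :
    (internalEndMonad S (RegularModule.of T (𝟙_ A)) (RegularModule T)).toFunctor.Additive :=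
  (isCocontinuous_internalEndMonad (isBicocontinuous_curriedAction hT)).additive

theorem linear_internalEndMonad (hT : IsCocontinuous k T) :
    (internalEndMonad S (RegularModule.of T (𝟙_ A)) (RegularModule T)).toFunctor.Linear k :=
  (isCocontinuous_internalEndMonad (isBicocontinuous_curriedAction hT)).linear

include hbox hT φ in
theorem exists_isRelativeTensorProduct_internalEndMonad
    [(internalEndMonad S (RegularModule.of T (𝟙_ A)) (RegularModule T)).toFunctor.Additive]
    [(internalEndMonad S (RegularModule.of T (𝟙_ A)) (RegularModule T)).toFunctor.Linear k] :
    ∃ B : BalancedFunctor k S (RegularModule T) (RegularModule T)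
      (internalEndMonad S (RegularModule.of T (𝟙_ A)) (RegularModule T)).Algebra,
      B.IsRelativeTensorProduct := by
  have := Cardinal.fact_isRegular_aleph0.{v}
  have hA := isBicocontinuous_curriedAction hT
  have hM := isCocontinuous_internalEndMonad (m := RegularModule.of T (𝟙_ A)) hA
  have := hM.preservesColimits
  have hH := isCocontinuous_internalHom_unit φ hbox
  have := isIso_internalHomTensor_unit φ hbox hT
  have := isSplitEpi_internalEval (boxUnitIso φ)
  have hB := isBicocontinuous_internalHomTensorFunctor hA hH
  exact ⟨BalancedFunctor.internalHomBalanced k (RegularModule T) _ hB,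
    { locallyFinitelyPresentable := isLocallyFinitelyPresentable_algebra _
      isQuasiProper := isQuasiProper_internalHomTensorFunctor (boxUnitIso φ)
        (fun n X hn hX => isFinitelyPresentable_box_smul φ hn IsTensorCategory.compact_unit hX)
      universal := fun E _ _ _ _ => BalancedFunctor.isEquivalence_postcomp hB hM }⟩

end

end Regular

section Modules

open Functor.Monoidal Functor.LaxMonoidal Functor.OplaxMonoidal MonObj

variable {k : Type v} [Field k]
  {A : Type (v + 1)} [Category.{v} A] [MonoidalCategory A]
  {S : Type (v + 1)} [Category.{v} S] [MonoidalCategory S]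
  (T : S ⥤ A) [T.Monoidal] (hT : T.IsLeftAdjoint)

/-- The monad `X ↦ T (End_S (1_A)) ⊗ X` on `A`. -/
noncomputable abbrev coendMonad : Monad (RegularModule T) :=
  have := RegularModule.isLeftAdjoint_actionLeft T hT
  internalEndMonad S (RegularModule.of T (𝟙_ A)) (RegularModule T)

/-- The unit of the monad `coendMonad`, as a morphism of `A`. -/
noncomputable def coendMonadUnit (X : A) : X ⟶ (coendAlgebra T hT).X ⊗ X :=
  (coendMonad T hT).η.app X

/-- The multiplication of the monad `coendMonad`, as a morphism of `A`. -/
noncomputable def coendMonadMul (X : A) :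
    (coendAlgebra T hT).X ⊗ (coendAlgebra T hT).X ⊗ X ⟶ (coendAlgebra T hT).X ⊗ X :=
  (coendMonad T hT).μ.app X

theorem coendMonadUnit_eq (X : A) :
    coendMonadUnit T hT X = (λ_ X).inv ≫ η[(coendAlgebra T hT).X] ▷ X := by
  have := RegularModule.isLeftAdjoint_actionLeft T hT
  change ((λ_ X).inv ≫ ε T ▷ X) ≫ T.map (internalEndUnit (RegularModule.of T (𝟙_ A))) ▷ X =
    (λ_ X).inv ≫ (ε T ≫ T.map (internalEnd S (RegularModule.of T (𝟙_ A))).mon.one) ▷ X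
  rw [one_internalEnd, comp_whiskerRight, Category.assoc]
  rfl

theorem coendMonadMul_eq (X : A) :
    coendMonadMul T hT X = (α_ _ _ X).inv ≫ μ[(coendAlgebra T hT).X] ▷ X := by
  have := RegularModule.isLeftAdjoint_actionLeft T hT
  change ((α_ _ _ X).inv ≫ Functor.LaxMonoidal.μ T _ _ ▷ X) ≫
    T.map (internalEndAct (RegularModule.of T (𝟙_ A)) (RegularModule.of T (𝟙_ A))) ▷ X =
    (α_ _ _ X).inv ≫ (Functor.LaxMonoidal.μ T _ _ ≫
      T.map (internalEnd S (RegularModule.of T (𝟙_ A))).mon.mul) ▷ X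
  rw [mul_internalEnd, comp_whiskerRight, Category.assoc]
  rfl

theorem coendMonadUnit_comp_eq_id_iff {X : A} (f : (coendAlgebra T hT).X ⊗ X ⟶ X) :
    coendMonadUnit T hT X ≫ f = 𝟙 X ↔ η[(coendAlgebra T hT).X] ▷ X ≫ f = (λ_ X).hom := by
  rw [coendMonadUnit_eq, Category.assoc, Iso.inv_comp_eq, Category.comp_id]

theorem coendMonadMul_comp_iff {X : A} (f : (coendAlgebra T hT).X ⊗ X ⟶ X) :
    coendMonadMul T hT X ≫ f = (coendAlgebra T hT).X ◁ f ≫ f ↔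
      μ[(coendAlgebra T hT).X] ▷ X ≫ f = (α_ _ _ X).hom ≫ (coendAlgebra T hT).X ◁ f ≫ f := by
  rw [coendMonadMul_eq, Category.assoc, Iso.inv_comp_eq]

/-- Algebras over the monad `coendMonad` are modules over `coendAlgebra`. -/
noncomputable def coendAlgebraEquivalence :
    (coendMonad T hT).Algebra ≌ CategoryTheory.Mod A (coendAlgebra T hT).X where
  functor :=
    { obj := fun X =>
        { X := X.A
          mod :=
            { smul := X.a
              one_smul := (coendMonadUnit_comp_eq_id_iff T hT (X := X.A) X.a).1 X.unit
              mul_smul := (coendMonadMul_comp_iff T hT (X := X.A) X.a).1 X.assoc } }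
      map := fun f => Mod.Hom.mk' f.f f.h.symm
      map_id := fun _ => Mod.hom_ext _ _ rfl
      map_comp := fun _ _ => Mod.hom_ext _ _ rfl }
  inverse :=
    { obj := fun X =>
        { A := X.X
          a := X.mod.smul
          unit := (coendMonadUnit_comp_eq_id_iff T hT X.mod.smul).2 X.mod.one_smul
          assoc := (coendMonadMul_comp_iff T hT X.mod.smul).2 X.mod.mul_smul }
      map := fun f =>
        { f := f.hom
          h := f.isModHom.smul_hom.symm }
      map_id := fun _ => rfl
      map_comp := fun _ _ => rfl }
  unitIso := Iso.refl _
  counitIso := Iso.refl _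
  functor_unitIso_comp _ := Mod.hom_ext _ _ (Category.comp_id _)

end Modules

section Transport

variable {k : Type v} [Field k]
  {C : Type (v + 1)} [Category.{v} C] [MonoidalCategory C]
  {M : Type (v + 1)} [Category.{v} M] [Preadditive M] [Linear k M] [MonoidalRightAction C M]
  {N : Type (v + 1)} [Category.{v} N] [Preadditive N] [Linear k N] [MonoidalLeftAction C N]
  {P : Type (v + 1)} [Category.{v} P] [Preadditive P] [Linear k P]
  {P' : Type (v + 1)} [Category.{v} P'] [Preadditive P'] [Linear k P']

theorem isCocontinuous_of_isEquivalence (F : P ⥤ P') [F.IsEquivalence] [F.Additive]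
    [F.Linear k] : IsCocontinuous k F :=
  ⟨inferInstance, inferInstance, inferInstance⟩

theorem isCocontinuous_inverse (e : P ≌ P') [e.functor.Additive] [e.functor.Linear k] :
    IsCocontinuous k e.inverse :=
  have : e.inverse.Additive := e.inverse_additive
  isCocontinuous_of_isEquivalence e.inverse

namespace BalancedFunctor

/-- Postcomposition of balanced functors with a cocontinuous functor, as a functor. -/
def mapTarget (G : CocontinuousFunctor k P P') :
    BalancedFunctor k C M N P ⥤ BalancedFunctor k C M N P' where
  obj B := (B.postcomp P').obj G
  map {B B'} σ :=
    { natTrans := Functor.whiskerRight (Hom.natTrans σ) ((Functor.whiskeringRight N P P').obj G.obj)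
      comm := fun m c n => by
        have h := congrArg G.obj.map (Hom.comm σ m c n)
        simpa [postcomp] using h }
  map_id B := Hom.ext (by ext; exact G.obj.map_id _)
  map_comp f g := Hom.ext (by ext; exact G.obj.map_comp _ _)

theorem isEquivalence_postcomp_of_equivalence (B : BalancedFunctor k C M N P) (e : P ≌ P')
    [e.functor.Additive] [e.functor.Linear k] (E : Type (v + 1)) [Category.{v} E]
    [Preadditive E] [Linear k E] [(B.postcomp E).IsEquivalence] :
    (((B.postcomp P').obj ⟨e.functor, isCocontinuous_of_isEquivalence e.functor⟩).postcomp
      E).IsEquivalence := by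
  let K : CocontinuousFunctor k P' E ⥤ CocontinuousFunctor k P E :=
    ObjectProperty.lift _ (ObjectProperty.ι _ ⋙ (Functor.whiskeringLeft P P' E).obj e.functor)
      (fun L => (isCocontinuous_of_isEquivalence e.functor).comp L.property)
  have : K.EssSurj := ⟨fun L => ⟨⟨e.inverse ⋙ L.obj, (isCocontinuous_inverse e).comp L.property⟩,
    ⟨ObjectProperty.isoMk _ (Functor.isoWhiskerRight e.unitIso.symm L.obj)⟩⟩⟩
  have : K.IsEquivalence := { }
  exact Functor.isEquivalence_of_iso (F := K ⋙ B.postcomp E)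
    (NatIso.ofComponents (fun L => Iso.refl _)
      (fun f => (Category.comp_id _).trans (Category.id_comp _).symm))

theorem IsRelativeTensorProduct.of_equivalence {B : BalancedFunctor k C M N P}
    (hB : B.IsRelativeTensorProduct) (e : P ≌ P') [e.functor.Additive] [e.functor.Linear k] :
    ((B.postcomp P').obj
      ⟨e.functor, isCocontinuous_of_isEquivalence e.functor⟩).IsRelativeTensorProduct where
  locallyFinitelyPresentable := by
    have := Cardinal.fact_isRegular_aleph0.{v}
    have : IsCardinalLocallyPresentable P Cardinal.aleph0.{v} := hB.locallyFinitelyPresentable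
    exact e.isCardinalLocallyPresentable Cardinal.aleph0.{v}
  isQuasiProper m n hm hn := by
    have := Cardinal.fact_isRegular_aleph0.{v}
    have : IsCardinalPresentable ((B.functor.obj m).obj n) Cardinal.aleph0.{v} :=
      hB.isQuasiProper m n hm hn
    exact (isCardinalPresentable_iff_of_isEquivalence _ Cardinal.aleph0.{v} e.functor).2 this
  universal E _ _ _ _ :=
    have := hB.universal E
    isEquivalence_postcomp_of_equivalence B e E

/-- The isomorphism that exhibits the comparison functors between two universal balanced functors as
mutually inverse. -/
noncomputable def comparisonIso {B : BalancedFunctor k C M N P} {B' : BalancedFunctor k C M N P'}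
    [(B.postcomp P).IsEquivalence] {F : CocontinuousFunctor k P P'}
    {G : CocontinuousFunctor k P' P} (e : (B.postcomp P').obj F ≅ B')
    (e' : (B'.postcomp P).obj G ≅ B) : F.obj ⋙ G.obj ≅ 𝟭 P :=
  let I : CocontinuousFunctor k P P := ⟨𝟭 P, ⟨inferInstance, inferInstance, inferInstance⟩⟩
  let FG : CocontinuousFunctor k P P := ⟨F.obj ⋙ G.obj, F.property.comp G.property⟩
  let i : (B.postcomp P).obj FG ≅ (B.postcomp P).obj I := (mapTarget G).mapIso e ≪≫ e'
  (ObjectProperty.ι _).mapIso ((B.postcomp P).preimageIso i)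

theorem IsRelativeTensorProduct.exists_equivalence {B : BalancedFunctor k C M N P}
    {B' : BalancedFunctor k C M N P'} (hB : B.IsRelativeTensorProduct)
    (hB' : B'.IsRelativeTensorProduct) :
    ∃ e : P ≌ P', e.functor.Additive ∧ e.functor.Linear k := by
  have := hB.locallyFinitelyPresentable
  have := hB'.locallyFinitelyPresentable
  have := hB.universal P
  have := hB.universal P'
  have := hB'.universal P
  have := hB'.universal P'
  let F := (B.postcomp P').objPreimage B'
  let G := (B'.postcomp P).objPreimage B
  let e : (B.postcomp P').obj F ≅ B' := (B.postcomp P').objObjPreimageIso B'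
  let e' : (B'.postcomp P).obj G ≅ B := (B'.postcomp P).objObjPreimageIso B
  exact ⟨CategoryTheory.Equivalence.mk F.obj G.obj (comparisonIso e e').symm (comparisonIso e' e),
    F.property.additive, F.property.linear⟩

end BalancedFunctor

end Transport

end LinearLFP

theorem mainTheorem11 (k : Type v) [Field k]
    (A : Type (v + 1)) [Category.{v} A] [Preadditive A] [Linear k A] [MonoidalCategory A]
    [MonoidalPreadditive A] [MonoidalLinear k A] [LinearLFP.IsTensorCategory A] [BraidedCategory A]
    (S : Type (v + 1)) [Category.{v} S] [Preadditive S] [Linear k S] [MonoidalCategory S]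
    [MonoidalPreadditive S] [MonoidalLinear k S] [LinearLFP.IsMonoidalCocontinuous S]
    (box : A × A ⥤ S) [box.Monoidal]
    (hbox : LinearLFP.IsKellyTensorProduct k (Functor.curry.obj box))
    (T : S ⥤ A) [T.Monoidal] (hT : LinearLFP.IsCocontinuous k T)
    (φ : box ⋙ T ≅ tensor A) [NatTrans.IsMonoidal φ.hom] :
    (∃ B : LinearLFP.BalancedFunctor k S (LinearLFP.RegularModule T) (LinearLFP.RegularModule T)
        (CategoryTheory.Mod A (LinearLFP.coendAlgebra T (hbox.isLeftAdjoint hT)).X),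
      B.IsRelativeTensorProduct) ∧
    ∀ (P : Type (v + 1)) [Category.{v} P] [Preadditive P] [Linear k P]
      (B : LinearLFP.BalancedFunctor k S (LinearLFP.RegularModule T)
        (LinearLFP.RegularModule T) P),
      B.IsRelativeTensorProduct →
        ∃ e : P ≌ CategoryTheory.Mod A (LinearLFP.coendAlgebra T (hbox.isLeftAdjoint hT)).X,
          e.functor.Additive ∧ e.functor.Linear k := by
  have hT' := hbox.isLeftAdjoint hT
  have := LinearLFP.RegularModule.isLeftAdjoint_actionLeft T hT'
  have := LinearLFP.additive_internalEndMonad hT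
  have := LinearLFP.linear_internalEndMonad hT
  obtain ⟨B, hB⟩ := LinearLFP.exists_isRelativeTensorProduct_internalEndMonad φ hbox hT
  let e := LinearLFP.coendAlgebraEquivalence T hT'
  have : e.functor.Additive := ⟨Mod.hom_ext _ _ rfl⟩
  have : e.functor.Linear k := ⟨fun _ _ => Mod.hom_ext _ _ rfl⟩
  have hB' := hB.of_equivalence e
  exact ⟨⟨_, hB'⟩, fun P _ _ _ B₁ hB₁ => hB₁.exists_equivalence hB'⟩
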